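/- Let $E$ be a smooth manifold of dimension $N$ and $H$ a smooth closed $3$-form on $E$. Let $T^*LE=LT^*E$ be the space of smooth loops $t\mapsto(x(t),p(t))$ in $T^*E$, with the twisted symplectic form $\omega_H=\omega+q^*\tau(H)$, which in Darboux coordinates $(x^i,p_i)$ on $T^*E$ induced by a chart of $E$ is $$\omega_H(Y,Z)=\int_{S^1}\Big(\sum_i (dp_i\wedge dx^i)(Y,Z)+H_{x(t)}(\partial x,Y_x,Z_x)\Big)dt ,$$ where $Y_x,Z_x$ are the $x$-components of $Y,Z$. A local function is a smooth function of the $k$-jet of a loop in $T^*E$, for some finite $k$. Write $u=(x,p)$ for the Darboux coordinates, $u_i^{(m)}$ for the jet coordinates, and $\partial=\sum_{i,m}u_i^{(m+1)}\partial/\partial u_i^{(m)}$ for the total derivative. Let $X_{u_i}$ be the Hamiltonian vector of $u_i$, defined pointwise along the loop by $\iota_{X_{u_i}}\omega_H=du_i$, with $\omega_H$ also denoting its integrand. Fix a sign $\varepsilon\in\{1,-1\}$ and let $B_{ij}=\varepsilon\,\omega_H(X_{u_i},X_{u_j})$, so that $\{u_i(t),u_j(s)\}=B_{ij}\,\delta(t-s)$.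 For $\varepsilon=1$ this is the bracket $\{f,g\}=\omega_H(X_f,X_g)$; for $\varepsilon=-1$ it is its negative, which is normalised by $\{x^i(t),p_j(s)\}=\delta^i_j\,\delta(t-s)$. The bracket induces on local functions the $\lambda$-bracket $$\{f_\lambda g\}=\sum_{i,j,m,n}\frac{\partial g}{\partial u_j^{(n)}}(\partial+\lambda)^n B_{ij}(-\partial-\lambda)^m\frac{\partial f}{\partial u_i^{(m)}},$$ the products $f_{(j)}g=\frac{d^j}{d\lambda^j}\{f_\lambda g\}\big|_{\lambda=0}$, the Dorfman bracket $\llbracket f,g\rrbracket=\{f_\lambda g\}|_{\lambda=0}$, and the symmetric pairing $$\langle f,g\rangle=\frac12\sum_{j\ge1}\frac{(-\partial)^{j-1}}{j!}\big(f_{(j)}g+g_{(j)}f\big).$$ For smooth sections $(\xi,\alpha),(\chi,\beta)$ of $TE\oplus T^*E$ put $$f_{(\xi,\alpha)}=\iota_{\partial x}\alpha+\iota_\xi p,\qquad \langle(\xi,\alpha),(\chi,\beta)\rangle=\tfrac12(\iota_\chi\alpha+\iota_\xi\beta),$$ $$\llbracket(\xi,\alpha),(\chi,\beta)\rrbracket_H=\big([\xi,\chi],\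 \mathcal L_\xi\beta-\iota_\chi d\alpha+\iota_\xi\iota_\chi H\big),\qquad \iota_\xi\iota_\chi H=H(\chi,\xi,\cdot).$$ Then $\llbracket(\xi,\alpha),(\chi,\beta)\rrbracket_H$ is again a smooth section, $f_{(\xi,\alpha)}$ and $f_{(\chi,\beta)}$ are local functions, and, in every Darboux chart induced by a chart of $E$, $$\llbracket f_{(\xi,\alpha)},f_{(\chi,\beta)}\rrbracket=\varepsilon\, f_{\llbracket(\xi,\alpha),(\chi,\beta)\rrbracket_H},\qquad \langle f_{(\xi,\alpha)},f_{(\chi,\beta)}\rangle=2\varepsilon\,\langle(\xi,\alpha),(\chi,\beta)\rangle .$$ Moreover $f_{(\xi,\alpha)(1)}f_{(\chi,\beta)}=2\varepsilon\,\langle(\xi,\alpha),(\chi,\beta)\rangle$, and $f_{(\xi,\alpha)(j)}f_{(\chi,\beta)}=0$ for all $j\ge2$. -/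

import Mathlib

open scoped Manifold ContDiff

noncomputable section

namespace ASCurrents

/-! ### Jets in Darboux coordinates and the calculus of local functions -/

/-- Labels of Darboux coordinates `u = (x, p)` on `T*ℝᴺ`: `inl i` labels `xⁱ`, `inr i` labels
`pᵢ`. -/
abbrev Idx (N : ℕ) : Type := Fin N ⊕ Fin N

/-- Infinite jets of curves in `T*ℝᴺ`: `u m i` is the jet coordinate `uᵢ⁽ᵐ⁾`. -/
abbrev Jet (N : ℕ) : Type := ℕ → Idx N → ℝ

/-- The position `x` of a point of phase space. -/
def position {N : ℕ} (w : Idx N → ℝ) : EuclideanSpace ℝ (Fin N) :=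
  WithLp.toLp 2 (fun i => w (Sum.inl i))

/-- The partial derivative `∂f / ∂uᵢ⁽ᵐ⁾`. -/
def partialD {N : ℕ} (i : Idx N) (m : ℕ) (f : Jet N → ℝ) (u : Jet N) : ℝ :=
  deriv (fun s : ℝ => f (Function.update u m (Function.update (u m) i s))) (u m i)

/-- The total derivative `∂f = ∑ uᵢ⁽ᵐ⁺¹⁾ ∂f/∂uᵢ⁽ᵐ⁾` in the loop direction. For a function that
depends on finitely many jet coordinates the sum is finite. -/
def totalD {N : ℕ} (f : Jet N → ℝ) (u : Jet N) : ℝ :=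
  ∑ᶠ q : Idx N × ℕ, u (q.2 + 1) q.1 * partialD q.1 q.2 f u

/-- The operator `∂ + l`. -/
def shiftD {N : ℕ} (l : ℝ) (f : Jet N → ℝ) (u : Jet N) : ℝ :=
  totalD f u + l * f u

/-- The operator `-∂ - l`. -/
def negShiftD {N : ℕ} (l : ℝ) (f : Jet N → ℝ) (u : Jet N) : ℝ :=
  -shiftD l f u

/-- The `λ`-bracket, at the real value `l` of the parameter,
`{f_l g} = ∑ ∂g/∂uⱼ⁽ⁿ⁾ (∂ + l)ⁿ Bᵢⱼ (-∂ - l)ᵐ ∂f/∂uᵢ⁽ᵐ⁾`,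
of the ultralocal Poisson bracket `{uᵢ(t), uⱼ(s)} = Bᵢⱼ δ(t - s)`. -/
def lambdaBracket {N : ℕ} (B : Idx N → Idx N → Jet N → ℝ) (l : ℝ) (f g : Jet N → ℝ)
    (u : Jet N) : ℝ :=
  ∑ᶠ q : (Idx N × ℕ) × (Idx N × ℕ),
    partialD q.2.1 q.2.2 g u *
      ((shiftD l)^[q.2.2] (fun w => B q.1.1 q.2.1 w *
        ((negShiftD l)^[q.1.2] (partialD q.1.1 q.1.2 f)) w)) u

/-- The `j`-th product `f₍ⱼ₎g`, the `j`-th derivative of the `λ`-bracket at `λ = 0`. -/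
def jProduct {N : ℕ} (B : Idx N → Idx N → Jet N → ℝ) (j : ℕ) (f g : Jet N → ℝ)
    (u : Jet N) : ℝ :=
  iteratedDeriv j (fun l : ℝ => lambdaBracket B l f g u) 0

/-- The Dorfman bracket `⟦f, g⟧ = {f_λ g}` at `λ = 0`. -/
def inducedDorfman {N : ℕ} (B : Idx N → Idx N → Jet N → ℝ) (f g : Jet N → ℝ)
    (u : Jet N) : ℝ :=
  lambdaBracket B 0 f g u

/-- The symmetric pairing
`⟨f, g⟩ = ½ ∑_{j ≥ 1} (-∂)ʲ⁻¹ / j! (f₍ⱼ₎g + g₍ⱼ₎f)`,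
normalised so that `⟦f, g⟧ + ⟦g, f⟧ = ∂⟨f, g⟩`. The summation index below is `j - 1`. -/
def inducedPairing {N : ℕ} (B : Idx N → Idx N → Jet N → ℝ) (f g : Jet N → ℝ)
    (u : Jet N) : ℝ :=
  (1 / 2 : ℝ) * ∑ᶠ j : ℕ, (1 / ((j + 1).factorial : ℝ)) *
    ((negShiftD 0)^[j] (fun w => jProduct B (j + 1) f g w + jProduct B (j + 1) g f w)) u

/-! ### The twisted symplectic form in Darboux coordinates -/

theorem update_one {V : Type*} (a b c y : V) :
    Function.update ![a, b, c] 1 y = ![a, y, c] := by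
  ext i
  fin_cases i <;> rfl

theorem update_two {V : Type*} (a b c y : V) :
    Function.update ![a, b, c] 2 y = ![a, b, y] := by
  ext i
  fin_cases i <;> rfl

/-- The density of `ω_H = ω + q^* τ(H)` along a loop, in Darboux coordinates, at a point where
the three-form is `h` and the velocity of the loop is `v`:
`ω_H(Y, Z) = ∑ᵢ (dpᵢ ∧ dxⁱ)(Y, Z) + h(v, Y_x, Z_x)`. The form on `T*LE` is the integral of this
density over the circle. -/
def twistedForm {N : ℕ} (h : EuclideanSpace ℝ (Fin N) [⋀^Fin 3]→L[ℝ] ℝ)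
    (v : EuclideanSpace ℝ (Fin N)) : LinearMap.BilinForm ℝ (Idx N → ℝ) :=
  LinearMap.mk₂ ℝ
    (fun Y Z => ∑ i : Fin N, (Y (Sum.inr i) * Z (Sum.inl i) - Z (Sum.inr i) * Y (Sum.inl i)) +
      h ![v, position Y, position Z])
    (by
      intro Y Y' Z
      have h1 : position (Y + Y') = position Y + position Y' := rfl
      have h2 := h.map_update_add ![v, 0, position Z] 1 (position Y) (position Y')
      simp only [update_one] at h2
      rw [h1, h2, add_add_add_comm, ← Finset.sum_add_distrib]
      congr 1
      refine Finset.sum_congr rfl fun i _ => ?_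
      simp only [Pi.add_apply]
      ring)
    (by
      intro a Y Z
      have h1 : position (a • Y) = a • position Y := rfl
      have h2 := h.map_update_smul ![v, 0, position Z] 1 a (position Y)
      simp only [update_one] at h2
      rw [h1, h2, smul_add, Finset.smul_sum]
      congr 1
      refine Finset.sum_congr rfl fun i _ => ?_
      simp only [Pi.smul_apply, smul_eq_mul]
      ring)
    (by
      intro Y Z Z'
      have h1 : position (Z + Z') = position Z + position Z' := rfl
      have h2 := h.map_update_add ![v, position Y, 0] 2 (position Z) (position Z')
      simp only [update_two] at h2
      rw [h1, h2, add_add_add_comm, ← Finset.sum_add_distrib]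
      congr 1
      refine Finset.sum_congr rfl fun i _ => ?_
      simp only [Pi.add_apply]
      ring)
    (by
      intro a Y Z
      have h1 : position (a • Z) = a • position Z := rfl
      have h2 := h.map_update_smul ![v, position Y, 0] 2 a (position Z)
      simp only [update_two] at h2
      rw [h1, h2, smul_add, Finset.smul_sum]
      congr 1
      refine Finset.sum_congr rfl fun i _ => ?_
      simp only [Pi.smul_apply, smul_eq_mul]
      ring)

theorem twistedForm_apply {N : ℕ} (h : EuclideanSpace ℝ (Fin N) [⋀^Fin 3]→L[ℝ] ℝ)
    (v : EuclideanSpace ℝ (Fin N)) (Y Z : Idx N → ℝ) :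
    twistedForm h v Y Z =
      ∑ i : Fin N, (Y (Sum.inr i) * Z (Sum.inl i) - Z (Sum.inr i) * Y (Sum.inl i)) +
        h ![v, position Y, position Z] := rfl

theorem twistedForm_swap {N : ℕ} (h : EuclideanSpace ℝ (Fin N) [⋀^Fin 3]→L[ℝ] ℝ)
    (v : EuclideanSpace ℝ (Fin N)) (Y Z : Idx N → ℝ) :
    twistedForm h v Y Z = -twistedForm h v Z Y := by
  have h2 := h.toAlternatingMap.map_swap ![v, position Z, position Y] (i := 1) (j := 2) (by decide)
  have h3 : (![v, position Z, position Y] ∘ Equiv.swap (1 : Fin 3) 2) =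
      ![v, position Y, position Z] := by
    ext i
    fin_cases i <;> rfl
  rw [h3] at h2
  have h4 : h ![v, position Y, position Z] = -h ![v, position Z, position Y] := h2
  rw [twistedForm_apply, twistedForm_apply, h4, neg_add, ← Finset.sum_neg_distrib]
  congr 1
  exact Finset.sum_congr rfl fun i _ => by ring

theorem twistedForm_nondegenerate {N : ℕ} (h : EuclideanSpace ℝ (Fin N) [⋀^Fin 3]→L[ℝ] ℝ)
    (v : EuclideanSpace ℝ (Fin N)) : (twistedForm h v).Nondegenerate := by
  have key : ∀ Y : Idx N → ℝ, (∀ Z, twistedForm h v Y Z = 0) → Y = 0 := by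
    intro Y hY
    have hx : ∀ i, Y (Sum.inl i) = 0 := by
      intro i
      have h1 := hY (Pi.single (Sum.inr i) 1)
      have h2 : position (Pi.single (Sum.inr i) 1 : Idx N → ℝ) = 0 := by
        ext k
        simp [position]
      have h3 := h.map_coord_zero (m := ![v, position Y, 0]) 2 rfl
      rw [twistedForm_apply, h2, h3] at h1
      simpa [Pi.single_apply] using h1
    have hpos : position Y = 0 := by
      ext k
      simp [position, hx]
    funext i
    rcases i with i | i
    · exact hx i
    · have h1 := hY (Pi.single (Sum.inl i) 1)
      have h3 := h.map_coord_zero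
        (m := ![v, 0, position (Pi.single (Sum.inl i) 1 : Idx N → ℝ)]) 1 rfl
      rw [twistedForm_apply, hpos, h3] at h1
      simpa [Pi.single_apply] using h1
  refine ⟨key, fun Z hZ => key Z fun Y => ?_⟩
  rw [twistedForm_swap, hZ, neg_zero]

/-- The Hamiltonian vector `X` of the coordinate `uᵢ`, determined by `ι_X ω_H = duᵢ`. -/
def hamiltonian {N : ℕ} (h : EuclideanSpace ℝ (Fin N) [⋀^Fin 3]→L[ℝ] ℝ)
    (v : EuclideanSpace ℝ (Fin N)) (i : Idx N) : Idx N → ℝ :=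
  ((twistedForm h v).toDual (twistedForm_nondegenerate h v)).symm (LinearMap.proj i)

/-- The Poisson tensor `Bᵢⱼ = ε ω_H(X_{uᵢ}, X_{uⱼ})` as a function of the jet of a loop, for a
three-form `h` on a domain of `ℝᴺ` and a choice of sign convention `ε`. -/
def poissonTensor {N : ℕ} (ε : ℝ)
    (h : EuclideanSpace ℝ (Fin N) → EuclideanSpace ℝ (Fin N) [⋀^Fin 3]→L[ℝ] ℝ)
    (i j : Idx N) (u : Jet N) : ℝ :=
  ε * twistedForm (h (position (u 0))) (position (u 1))
    (hamiltonian (h (position (u 0))) (position (u 1)) i)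
    (hamiltonian (h (position (u 0))) (position (u 1)) j)

/-! ### Differential forms and the generalised tangent bundle -/

section Manifold

variable {N : ℕ} {E : Type*} [TopologicalSpace E] [ChartedSpace (EuclideanSpace ℝ (Fin N)) E]

/-- The expression of a one-form in a chart. -/
def oneFormInChart (φ : OpenPartialHomeomorph E (EuclideanSpace ℝ (Fin N)))
    (α : (x : E) → TangentSpace (𝓡 N) x →L[ℝ] ℝ) (y : EuclideanSpace ℝ (Fin N)) :
    EuclideanSpace ℝ (Fin N) →L[ℝ] ℝ :=
  (α (φ.symm y)).comp (mfderiv (𝓡 N) (𝓡 N) φ.symm y)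

/-- The expression of a three-form in a chart. -/
def threeFormInChart (φ : OpenPartialHomeomorph E (EuclideanSpace ℝ (Fin N)))
    (H : (x : E) → TangentSpace (𝓡 N) x [⋀^Fin 3]→L[ℝ] ℝ) (y : EuclideanSpace ℝ (Fin N)) :
    EuclideanSpace ℝ (Fin N) [⋀^Fin 3]→L[ℝ] ℝ :=
  (H (φ.symm y)).compContinuousLinearMap (mfderiv (𝓡 N) (𝓡 N) φ.symm y)

/-- Smooth one-forms. -/
def IsSmoothOneForm (α : (x : E) → TangentSpace (𝓡 N) x →L[ℝ] ℝ) : Prop :=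
  ∀ φ ∈ IsManifold.maximalAtlas (𝓡 N) ∞ E, ContDiffOn ℝ ∞ (oneFormInChart φ α) φ.target

/-- Smooth three-forms. -/
def IsSmoothThreeForm (H : (x : E) → TangentSpace (𝓡 N) x [⋀^Fin 3]→L[ℝ] ℝ) : Prop :=
  ∀ φ ∈ IsManifold.maximalAtlas (𝓡 N) ∞ E, ContDiffOn ℝ ∞ (threeFormInChart φ H) φ.target

/-- Closed three-forms. -/
def IsClosedThreeForm (H : (x : E) → TangentSpace (𝓡 N) x [⋀^Fin 3]→L[ℝ] ℝ) : Prop :=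
  ∀ φ ∈ IsManifold.maximalAtlas (𝓡 N) ∞ E, ∀ y ∈ φ.target,
    extDeriv (threeFormInChart φ H) y = 0

/-- The exterior derivative of a one-form, the one-form
`(dα)(v, ·) = (∂_v α)(·) - (∂_· α)(v)`, computed in the preferred chart at the point. -/
def extDerivOneForm (α : (x : E) → TangentSpace (𝓡 N) x →L[ℝ] ℝ) (x : E)
    (v : TangentSpace (𝓡 N) x) : TangentSpace (𝓡 N) x →L[ℝ] ℝ :=
  let φ := chartAt (EuclideanSpace ℝ (Fin N)) x
  let A : EuclideanSpace ℝ (Fin N) →L[ℝ] EuclideanSpace ℝ (Fin N) →L[ℝ] ℝ :=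
    fderiv ℝ (oneFormInChart φ α) (φ x)
  let D : TangentSpace (𝓡 N) x →L[ℝ] EuclideanSpace ℝ (Fin N) := mfderiv (𝓡 N) (𝓡 N) φ x
  ((A - A.flip) (D v)).comp D

/-- The Lie derivative of a one-form along a vector field, `ℒ_ξ β = ι_ξ dβ + d(ι_ξ β)`. -/
def lieDerivOneForm (ξ : (x : E) → TangentSpace (𝓡 N) x)
    (β : (x : E) → TangentSpace (𝓡 N) x →L[ℝ] ℝ) (x : E) : TangentSpace (𝓡 N) x →L[ℝ] ℝ :=
  extDerivOneForm β x (ξ x) + mvfderiv (𝓡 N) (fun y : E => β y (ξ y)) x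

/-- The one-form `ι_ξ ι_χ H = H(χ, ξ, ·)`. -/
def contractTwice (ξ χ : (x : E) → TangentSpace (𝓡 N) x)
    (H : (x : E) → TangentSpace (𝓡 N) x [⋀^Fin 3]→L[ℝ] ℝ) (x : E) :
    TangentSpace (𝓡 N) x →L[ℝ] ℝ :=
  (H x).toContinuousMultilinearMap.toContinuousLinearMap ![χ x, ξ x, 0] 2

variable (N E) in
/-- A (not necessarily smooth) section `(ξ, α)` of `TE ⊕ T*E`. -/
structure GenSection where
  /-- the vector field -/
  vec : (x : E) → TangentSpace (𝓡 N) x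
  /-- the one-form -/
  form : (x : E) → TangentSpace (𝓡 N) x →L[ℝ] ℝ

/-- Smooth sections of `TE ⊕ T*E`. -/
def GenSection.IsSmooth [IsManifold (𝓡 N) ∞ E] (a : GenSection N E) : Prop :=
  ContMDiff (𝓡 N) (𝓡 N).tangent ∞ (fun x => (⟨x, a.vec x⟩ : TangentBundle (𝓡 N) E)) ∧
    IsSmoothOneForm a.form

/-- The canonical pairing `⟨(ξ, α), (χ, β)⟩ = ½ (ι_χ α + ι_ξ β)`. -/
def GenSection.pairing (a b : GenSection N E) (x : E) : ℝ :=
  (1 / 2 : ℝ) * (a.form x (b.vec x) + b.form x (a.vec x))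

/-- The `H`-twisted Dorfman bracket
`⟦(ξ, α), (χ, β)⟧_H = ([ξ, χ], ℒ_ξ β - ι_χ dα + ι_ξ ι_χ H)`. -/
def GenSection.dorfman (H : (x : E) → TangentSpace (𝓡 N) x [⋀^Fin 3]→L[ℝ] ℝ)
    (a b : GenSection N E) : GenSection N E where
  vec := VectorField.mlieBracket (𝓡 N) a.vec b.vec
  form := fun x => lieDerivOneForm a.vec b.form x - extDerivOneForm a.form x (b.vec x) +
    contractTwice a.vec b.vec H x

/-! ### Loops in the cotangent bundle and local functions -/

variable (N E) in
/-- The points `(x, p)` of the cotangent bundle `T*E`. -/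
abbrev CotangentPoint : Type _ := (x : E) × (TangentSpace (𝓡 N) x →L[ℝ] ℝ)

/-- The Darboux coordinates `(xⁱ, pᵢ)` on `T*E` induced by a chart of `E`; here `pᵢ = p(∂/∂xⁱ)`. -/
def darboux (φ : OpenPartialHomeomorph E (EuclideanSpace ℝ (Fin N))) (z : CotangentPoint N E) :
    Idx N → ℝ :=
  Sum.elim (fun i => φ z.1 i)
    (fun i => z.2 ((mfderiv (𝓡 N) (𝓡 N) φ z.1).inverse
      (EuclideanSpace.single i (1 : ℝ) : EuclideanSpace ℝ (Fin N))))

variable (N E) in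
/-- Points of the phase space `T*LE = LT*E`: smooth loops in `T*E`, that is, smooth maps
`t ↦ (x(t), p(t))` of period one. -/
structure PhaseLoop where
  /-- the underlying map -/
  toFun : ℝ → CotangentPoint N E
  periodic : Function.Periodic toFun 1
  continuous_base : Continuous fun t => (toFun t).1
  smooth : ∀ t, ∃ φ ∈ IsManifold.maximalAtlas (𝓡 N) ∞ E,
    (toFun t).1 ∈ φ.source ∧ ContDiffAt ℝ ∞ (fun s => darboux φ (toFun s)) t

/-- The base loop `x`. -/
def PhaseLoop.base (c : PhaseLoop N E) (t : ℝ) : E := (c.toFun t).1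

/-- The momentum `p` along the loop. -/
def PhaseLoop.momentum (c : PhaseLoop N E) (t : ℝ) : TangentSpace (𝓡 N) (c.base t) →L[ℝ] ℝ :=
  (c.toFun t).2

/-- The velocity `∂x` of the base loop. -/
def PhaseLoop.velocity (c : PhaseLoop N E) (t : ℝ) : TangentSpace (𝓡 N) (c.base t) :=
  mfderiv 𝓘(ℝ, ℝ) (𝓡 N) c.base t (1 : ℝ)

/-- The jet at time `t` of a loop in the Darboux coordinates of a chart. -/
def PhaseLoop.jet (φ : OpenPartialHomeomorph E (EuclideanSpace ℝ (Fin N)))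
    (c : PhaseLoop N E) (t : ℝ) : Jet N :=
  fun m i => iteratedDeriv m (fun s => darboux φ (c.toFun s) i) t

/-- `f` is the expression, in the Darboux coordinates of the chart `φ`, of the function `F` of
loops and times, and this expression is a smooth function of the `k`-jet of the loop. Only the
values of `f` on jets whose position lies in the chart matter. -/
def IsChartExpr (k : ℕ) (φ : OpenPartialHomeomorph E (EuclideanSpace ℝ (Fin N)))
    (F : PhaseLoop N E → ℝ → ℝ) (f : Jet N → ℝ) : Prop :=
  (∃ g : (Fin (k + 1) → Idx N → ℝ) → ℝ,
    ContDiffOn ℝ ∞ g {w | position (w 0) ∈ φ.target} ∧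
      ∀ u : Jet N, position (u 0) ∈ φ.target → f u = g (fun m => u m)) ∧
  ∀ (c : PhaseLoop N E) (t : ℝ), c.base t ∈ φ.source → F c t = f (c.jet φ t)

/-- Local functions: smooth functions on the jet space of finite order of loops in `T*E`. -/
def IsLocal (F : PhaseLoop N E → ℝ → ℝ) : Prop :=
  ∃ k : ℕ, ∀ φ ∈ IsManifold.maximalAtlas (𝓡 N) ∞ E, ∃ f : Jet N → ℝ, IsChartExpr k φ F f

/-- `K` is the local function obtained from the local functions `F` and `G` by an operation `op`
that is given in Darboux coordinates: in every chart, whatever the expressions `f` and `g`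
of `F` and `G` are, the value of `K` is that of `op φ f g`. -/
def IsResult (op : OpenPartialHomeomorph E (EuclideanSpace ℝ (Fin N)) →
      (Jet N → ℝ) → (Jet N → ℝ) → Jet N → ℝ)
    (F G K : PhaseLoop N E → ℝ → ℝ) : Prop :=
  IsLocal F ∧ IsLocal G ∧ IsLocal K ∧
  ∀ φ ∈ IsManifold.maximalAtlas (𝓡 N) ∞ E, ∀ (k l : ℕ) (f g : Jet N → ℝ),
    IsChartExpr k φ F f → IsChartExpr l φ G g →
      ∀ (c : PhaseLoop N E) (t : ℝ), c.base t ∈ φ.source → op φ f g (c.jet φ t) = K c t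

/-- `⟦F, G⟧ = K` for the Dorfman bracket on local functions induced by `ε ω_H`. -/
def IsDorfman (ε : ℝ) (H : (x : E) → TangentSpace (𝓡 N) x [⋀^Fin 3]→L[ℝ] ℝ)
    (F G K : PhaseLoop N E → ℝ → ℝ) : Prop :=
  IsResult (fun φ => inducedDorfman (poissonTensor ε (threeFormInChart φ H))) F G K

/-- `⟨F, G⟩ = K` for the pairing on local functions induced by `ε ω_H`. -/
def IsPairing (ε : ℝ) (H : (x : E) → TangentSpace (𝓡 N) x [⋀^Fin 3]→L[ℝ] ℝ)
    (F G K : PhaseLoop N E → ℝ → ℝ) : Prop :=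
  IsResult (fun φ => inducedPairing (poissonTensor ε (threeFormInChart φ H))) F G K

/-- `F₍ⱼ₎G = K` for the `j`-th product on local functions induced by `ε ω_H`. -/
def IsJProduct (ε : ℝ) (H : (x : E) → TangentSpace (𝓡 N) x [⋀^Fin 3]→L[ℝ] ℝ) (j : ℕ)
    (F G K : PhaseLoop N E → ℝ → ℝ) : Prop :=
  IsResult (fun φ => jProduct (poissonTensor ε (threeFormInChart φ H)) j) F G K

/-- The Alekseev-Strobl function `f_{(ξ, α)} = ι_{∂x} α + ι_ξ p`. -/
def asFunction (a : GenSection N E) (c : PhaseLoop N E) (t : ℝ) : ℝ :=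
  a.form (c.base t) (c.velocity t) + c.momentum t (a.vec (c.base t))

end Manifold

end ASCurrents

end

/-!
Everything is local in a chart `φ` of `E`. There the Alekseev-Strobl function of `(ξ, α)` is the
current `A_x(∂x) + p(X)` on jets, where `A` and `X` are the expressions of `α` and `ξ`
(`asFunction_eq_current`), and the chart expression of a function of loops is unique on the jets over
the chart: every jet of finite order is the jet of a loop, namely of its Taylor polynomial composed
with a smooth periodic function that is the identity near `0` and has small range
(`exists_phaseLoop_of_jet`, `IsChartExpr.eqOn`). As all operations on local functions respect equality
over the chart (`lambdaBracket_congr`), they may be computed on currents.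

Inverting the twisted symplectic form gives the entries `0`, `∓ε δᵢⱼ` and `ε H(∂x, eⱼ, eᵢ)` of the
Poisson tensor. The `λ`-bracket of two currents is then a finite sum (`lambdaBracket_current`). Its
constant term is `ε` times the current of `([X, Y], ℒ_X C - ι_Y dA + ι_X ι_Y H)`, its slope is
`ε (A(Y) + C(X))`, and there are no higher powers of `λ`; here `C` and `Y` are the expressions of the
second section. The Dorfman bracket, the products and the pairing can be read off (`lambdaBracket_asFunction`,
`jProduct_asFunction`, `inducedPairing_asFunction`).

It remains to express the twisted Dorfman bracket of sections in the same chart. The Lie bracket is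
natural under pullback, and the exterior derivative, defined in the preferred chart at each point,
can be computed in any chart because the second derivative of the transition map is symmetric
(`extDerivOneForm_apply`). The resulting formula (`oneFormInChart_dorfman`) also shows that the
bracket is a smooth section.
-/

open scoped Topology

noncomputable section

namespace ASCurrents

/-! ### Tensor fields in charts -/

section Charts

variable {N : ℕ} {E : Type*} [TopologicalSpace E] [ChartedSpace (EuclideanSpace ℝ (Fin N)) E]

/-- The expression of a vector field in a chart, as the pullback along the inverse of the chart:
the Lie bracket is natural for such pullbacks. -/
def vecInChart (φ : OpenPartialHomeomorph E (EuclideanSpace ℝ (Fin N)))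
    (ξ : (x : E) → TangentSpace (𝓡 N) x) (y : EuclideanSpace ℝ (Fin N)) :
    EuclideanSpace ℝ (Fin N) :=
  VectorField.mpullback (𝓡 N) (𝓡 N) φ.symm ξ y

theorem two_le_smooth : (2 : ℕ∞ω) ≤ ∞ := by
  exact (WithTop.coe_le_coe.2 le_top : ((2 : ℕ∞) : ℕ∞ω) ≤ ∞)

theorem mdifferentiable_of_mem_maximalAtlas
    {φ : OpenPartialHomeomorph E (EuclideanSpace ℝ (Fin N))}
    (hφ : φ ∈ IsManifold.maximalAtlas (𝓡 N) ∞ E) : φ.MDifferentiable (𝓡 N) (𝓡 N) :=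
  ⟨(contMDiffOn_of_mem_maximalAtlas hφ).mdifferentiableOn (by simp),
    (contMDiffOn_symm_of_mem_maximalAtlas hφ).mdifferentiableOn (by simp)⟩

variable {φ ψ : OpenPartialHomeomorph E (EuclideanSpace ℝ (Fin N))}

theorem isInvertible_mfderiv_symm (hφ : φ ∈ IsManifold.maximalAtlas (𝓡 N) ∞ E)
    {y : EuclideanSpace ℝ (Fin N)} (hy : y ∈ φ.target) :
    (mfderiv (𝓡 N) (𝓡 N) φ.symm y).IsInvertible :=
  ⟨(mdifferentiable_of_mem_maximalAtlas hφ).symm.mfderiv hy, rfl⟩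

theorem mfderiv_symm_vecInChart (hφ : φ ∈ IsManifold.maximalAtlas (𝓡 N) ∞ E)
    (ξ : (x : E) → TangentSpace (𝓡 N) x) {y : EuclideanSpace ℝ (Fin N)} (hy : y ∈ φ.target) :
    mfderiv (𝓡 N) (𝓡 N) φ.symm y (vecInChart φ ξ y) = ξ (φ.symm y) :=
  (isInvertible_mfderiv_symm hφ hy).self_apply_inverse _

theorem mfderiv_symm_mfderiv (hφ : φ ∈ IsManifold.maximalAtlas (𝓡 N) ∞ E)
    {x : E} (hx : x ∈ φ.source) (v : TangentSpace (𝓡 N) x) :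
    mfderiv (𝓡 N) (𝓡 N) φ.symm (φ x) (mfderiv (𝓡 N) (𝓡 N) φ x v) = v :=
  DFunLike.congr_fun ((mdifferentiable_of_mem_maximalAtlas hφ).symm_comp_deriv hx) v

theorem mfderiv_mfderiv_symm (hφ : φ ∈ IsManifold.maximalAtlas (𝓡 N) ∞ E)
    {y : EuclideanSpace ℝ (Fin N)} (hy : y ∈ φ.target) (v : EuclideanSpace ℝ (Fin N)) :
    mfderiv (𝓡 N) (𝓡 N) φ (φ.symm y) (mfderiv (𝓡 N) (𝓡 N) φ.symm y v) = v :=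
  DFunLike.congr_fun ((mdifferentiable_of_mem_maximalAtlas hφ).comp_symm_deriv hy) v

theorem oneFormInChart_vecInChart (hφ : φ ∈ IsManifold.maximalAtlas (𝓡 N) ∞ E)
    (α : (x : E) → TangentSpace (𝓡 N) x →L[ℝ] ℝ) (ξ : (x : E) → TangentSpace (𝓡 N) x)
    {y : EuclideanSpace ℝ (Fin N)} (hy : y ∈ φ.target) :
    oneFormInChart φ α y (vecInChart φ ξ y) = α (φ.symm y) (ξ (φ.symm y)) :=
  congrArg (α (φ.symm y)) (mfderiv_symm_vecInChart hφ ξ hy)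

theorem contDiffOn_vecInChart [IsManifold (𝓡 N) ∞ E]
    (hφ : φ ∈ IsManifold.maximalAtlas (𝓡 N) ∞ E) {ξ : (x : E) → TangentSpace (𝓡 N) x}
    (hξ : ContMDiff (𝓡 N) (𝓡 N).tangent ∞ (fun x => (⟨x, ξ x⟩ : TangentBundle (𝓡 N) E))) :
    ContDiffOn ℝ ∞ (vecInChart φ ξ) φ.target := by
  have : IsManifold (𝓡 N) 1 E := IsManifold.of_le (n := ∞) (by simp)
  intro y hy
  have h := ContMDiffWithinAt.mpullback_vectorField_preimage (t := Set.univ) (m := ∞) (n := ∞)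
    (V := ξ) (x₀ := y) ((hξ _).contMDiffWithinAt) (contMDiffAt_symm_of_mem_maximalAtlas hφ hy)
    (isInvertible_mfderiv_symm hφ hy) (by simp)
  rw [Set.preimage_univ, contMDiffWithinAt_univ] at h
  exact (contMDiffAt_vectorSpace_iff_contDiffAt.1 h).contDiffWithinAt

theorem vecInChart_mlieBracket [IsManifold (𝓡 N) ∞ E]
    (hφ : φ ∈ IsManifold.maximalAtlas (𝓡 N) ∞ E) {ξ χ : (x : E) → TangentSpace (𝓡 N) x}
    (hξ : ContMDiff (𝓡 N) (𝓡 N).tangent ∞ (fun x => (⟨x, ξ x⟩ : TangentBundle (𝓡 N) E)))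
    (hχ : ContMDiff (𝓡 N) (𝓡 N).tangent ∞ (fun x => (⟨x, χ x⟩ : TangentBundle (𝓡 N) E)))
    {y : EuclideanSpace ℝ (Fin N)} (hy : y ∈ φ.target) :
    vecInChart φ (VectorField.mlieBracket (𝓡 N) ξ χ) y =
      fderiv ℝ (vecInChart φ χ) y (vecInChart φ ξ y) -
        fderiv ℝ (vecInChart φ ξ) y (vecInChart φ χ y) := by
  have : IsManifold (𝓡 N) (minSmoothness ℝ 2) E :=
    IsManifold.of_le (n := ∞) (by simpa using two_le_smooth)
  have h := VectorField.mpullback_mlieBracket (I := 𝓡 N) (I' := 𝓡 N) (f := φ.symm) (x₀ := y)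
    (V := ξ) (W := χ) (n := ∞) ((hξ _).mdifferentiableAt (by simp))
    ((hχ _).mdifferentiableAt (by simp)) (contMDiffAt_symm_of_mem_maximalAtlas hφ hy)
    (by simpa using two_le_smooth)
  refine h.trans ?_
  rw [← VectorField.mlieBracketWithin_univ, VectorField.mlieBracketWithin_eq_lieBracketWithin]
  exact congrFun VectorField.lieBracketWithin_univ y

theorem contMDiff_mlieBracket [IsManifold (𝓡 N) ∞ E] {ξ χ : (x : E) → TangentSpace (𝓡 N) x}
    (hξ : ContMDiff (𝓡 N) (𝓡 N).tangent ∞ (fun x => (⟨x, ξ x⟩ : TangentBundle (𝓡 N) E)))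
    (hχ : ContMDiff (𝓡 N) (𝓡 N).tangent ∞ (fun x => (⟨x, χ x⟩ : TangentBundle (𝓡 N) E))) :
    ContMDiff (𝓡 N) (𝓡 N).tangent ∞
      (fun x => (⟨x, VectorField.mlieBracket (𝓡 N) ξ χ x⟩ : TangentBundle (𝓡 N) E)) := by
  have : IsManifold (𝓡 N) (minSmoothness ℝ 2) E :=
    IsManifold.of_le (n := ∞) (by simpa using two_le_smooth)
  have : IsManifold (𝓡 N) (((⊤ : ℕ∞) : WithTop ℕ∞) + 1) E := by simpa
  exact fun x => ContMDiffAt.mlieBracket_vectorField (n := ⊤) (m := ⊤) (hξ x) (hχ x) (by simp)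

theorem contDiffAt_transition (hφ : φ ∈ IsManifold.maximalAtlas (𝓡 N) ∞ E)
    (hψ : ψ ∈ IsManifold.maximalAtlas (𝓡 N) ∞ E) {y : EuclideanSpace ℝ (Fin N)}
    (hy : y ∈ φ.target) (hy' : φ.symm y ∈ ψ.source) :
    ContDiffAt ℝ ∞ (ψ ∘ φ.symm) y :=
  contMDiffAt_iff_contDiffAt.1 <|
    (contMDiffAt_of_mem_maximalAtlas hψ hy').comp y (contMDiffAt_symm_of_mem_maximalAtlas hφ hy)

theorem fderiv_transition (hφ : φ ∈ IsManifold.maximalAtlas (𝓡 N) ∞ E)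
    (hψ : ψ ∈ IsManifold.maximalAtlas (𝓡 N) ∞ E) {y : EuclideanSpace ℝ (Fin N)}
    (hy : y ∈ φ.target) (hy' : φ.symm y ∈ ψ.source) (v : EuclideanSpace ℝ (Fin N)) :
    fderiv ℝ (ψ ∘ φ.symm) y v =
      mfderiv (𝓡 N) (𝓡 N) ψ (φ.symm y) (mfderiv (𝓡 N) (𝓡 N) φ.symm y v) := by
  have h := mfderiv_comp y ((mdifferentiable_of_mem_maximalAtlas hψ).mdifferentiableAt hy')
    ((mdifferentiable_of_mem_maximalAtlas hφ).mdifferentiableAt_symm hy)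
  rw [mfderiv_eq_fderiv] at h
  exact DFunLike.congr_fun h v

theorem oneFormInChart_transition (hφ : φ ∈ IsManifold.maximalAtlas (𝓡 N) ∞ E)
    (hψ : ψ ∈ IsManifold.maximalAtlas (𝓡 N) ∞ E)
    (α : (x : E) → TangentSpace (𝓡 N) x →L[ℝ] ℝ) {y : EuclideanSpace ℝ (Fin N)}
    (hy : y ∈ φ.target) (hy' : φ.symm y ∈ ψ.source) :
    oneFormInChart φ α y =
      (oneFormInChart ψ α ((ψ ∘ φ.symm) y)).comp (fderiv ℝ (ψ ∘ φ.symm) y) := by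
  ext v
  -- The point is a variable, so that it can be replaced by `ψ.symm (ψ (φ.symm y))` although the
  -- type of `α` depends on it.
  have key : ∀ (x : E) (hx : x = φ.symm y),
      α (φ.symm y) (mfderiv (𝓡 N) (𝓡 N) φ.symm y v) =
        α x (mfderiv (𝓡 N) (𝓡 N) ψ.symm (ψ (φ.symm y)) (fderiv ℝ (ψ ∘ φ.symm) y v)) := by
    rintro _ rfl
    rw [fderiv_transition hφ hψ hy hy', mfderiv_symm_mfderiv hψ hy']
  exact key _ (ψ.left_inv hy')

/-- The exterior derivative of a one-form does not depend on the chart in which it is computed: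
the second derivative of a transition map is symmetric. -/
theorem extDerivOneForm_apply [IsManifold (𝓡 N) ∞ E]
    (hφ : φ ∈ IsManifold.maximalAtlas (𝓡 N) ∞ E) {α : (x : E) → TangentSpace (𝓡 N) x →L[ℝ] ℝ}
    (hα : IsSmoothOneForm α) {y : EuclideanSpace ℝ (Fin N)} (hy : y ∈ φ.target)
    (v w : EuclideanSpace ℝ (Fin N)) :
    extDerivOneForm α (φ.symm y) (mfderiv (𝓡 N) (𝓡 N) φ.symm y v)
        (mfderiv (𝓡 N) (𝓡 N) φ.symm y w) =
      fderiv ℝ (oneFormInChart φ α) y v w - fderiv ℝ (oneFormInChart φ α) y w v := by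
  set ψ := chartAt (EuclideanSpace ℝ (Fin N)) (φ.symm y) with hψdef
  have hψ : ψ ∈ IsManifold.maximalAtlas (𝓡 N) ∞ E := IsManifold.chart_mem_maximalAtlas _
  have hy' : φ.symm y ∈ ψ.source := mem_chart_source _ _
  set τ : EuclideanSpace ℝ (Fin N) → EuclideanSpace ℝ (Fin N) := ψ ∘ φ.symm with hτ
  have hτs : ContDiffAt ℝ ∞ τ y := contDiffAt_transition hφ hψ hy hy'
  have hev : ∀ᶠ z in 𝓝 y, z ∈ φ.target ∧ φ.symm z ∈ ψ.source :=
    Filter.Eventually.and (φ.open_target.mem_nhds hy)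
      ((φ.symm.continuousAt hy).eventually (ψ.open_source.mem_nhds hy'))
  have hA : HasFDerivAt (oneFormInChart ψ α) (fderiv ℝ (oneFormInChart ψ α) (τ y)) (τ y) :=
    (((hα ψ hψ).contDiffAt (ψ.open_target.mem_nhds (ψ.map_source hy'))).differentiableAt
      (by simp)).hasFDerivAt
  have hτ1 : HasFDerivAt τ (fderiv ℝ τ y) y := (hτs.differentiableAt (by simp)).hasFDerivAt
  have hτ2 : HasFDerivAt (fderiv ℝ τ) (fderiv ℝ (fderiv ℝ τ) y) y :=
    ((hτs.fderiv_right (m := ∞) (by simp)).differentiableAt (by simp)).hasFDerivAt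
  have hder := ((hA.comp y hτ1).clm_comp hτ2).congr_of_eventuallyEq
    (f₁ := oneFormInChart φ α)
    (hev.mono fun z hz => oneFormInChart_transition hφ hψ α hz.1 hz.2)
  have hsymm : fderiv ℝ (fderiv ℝ τ) y v w = fderiv ℝ (fderiv ℝ τ) y w v :=
    (hτs.isSymmSndFDerivAt (by simpa using two_le_smooth)) v w
  rw [hder.fderiv]
  have h1 := fderiv_transition hφ hψ hy hy' v
  have h2 := fderiv_transition hφ hψ hy hy' w
  have lhs : extDerivOneForm α (φ.symm y) (mfderiv (𝓡 N) (𝓡 N) φ.symm y v)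
        (mfderiv (𝓡 N) (𝓡 N) φ.symm y w) =
      fderiv ℝ (oneFormInChart ψ α) (τ y) (fderiv ℝ τ y v) (fderiv ℝ τ y w) -
        fderiv ℝ (oneFormInChart ψ α) (τ y) (fderiv ℝ τ y w) (fderiv ℝ τ y v) := by
    rw [h1, h2]
    rfl
  rw [lhs]
  simp [hsymm]

theorem mvfderiv_apply_mfderiv_symm (hφ : φ ∈ IsManifold.maximalAtlas (𝓡 N) ∞ E) {f : E → ℝ}
    {y : EuclideanSpace ℝ (Fin N)} (hy : y ∈ φ.target)
    (hf : DifferentiableAt ℝ (f ∘ φ.symm) y) (v : EuclideanSpace ℝ (Fin N)) :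
    mvfderiv (𝓡 N) f (φ.symm y) (mfderiv (𝓡 N) (𝓡 N) φ.symm y v) =
      fderiv ℝ (f ∘ φ.symm) y v := by
  have hd := mdifferentiable_of_mem_maximalAtlas hφ
  have hx : φ.symm y ∈ φ.source := φ.map_target hy
  have hf' : MDifferentiableAt (𝓡 N) 𝓘(ℝ, ℝ) f (φ.symm y) := by
    have h1 : MDifferentiableAt (𝓡 N) 𝓘(ℝ, ℝ) (f ∘ φ.symm) (φ (φ.symm y)) := by
      rw [φ.right_inv hy]
      exact hf.mdifferentiableAt
    refine (h1.comp _ (hd.mdifferentiableAt hx)).congr_of_eventuallyEq ?_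
    filter_upwards [φ.open_source.mem_nhds hx] with z hz
    simp [φ.left_inv hz]
  have h := mfderiv_comp y hf' (hd.mdifferentiableAt_symm hy)
  rw [mfderiv_eq_fderiv] at h
  exact (DFunLike.congr_fun h v).symm

/-- The one-form of the twisted Dorfman bracket in a chart. The derivative of `β` in the direction
of the argument `w` does not appear: it cancels between `ι_ξ dβ` and `d(ι_ξ β)`. -/
theorem oneFormInChart_dorfman [IsManifold (𝓡 N) ∞ E]
    (hφ : φ ∈ IsManifold.maximalAtlas (𝓡 N) ∞ E)
    (H : (x : E) → TangentSpace (𝓡 N) x [⋀^Fin 3]→L[ℝ] ℝ) {a b : GenSection N E}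
    (ha : a.IsSmooth) (hb : b.IsSmooth) {y : EuclideanSpace ℝ (Fin N)} (hy : y ∈ φ.target)
    (w : EuclideanSpace ℝ (Fin N)) :
    oneFormInChart φ (GenSection.dorfman H a b).form y w =
      fderiv ℝ (oneFormInChart φ b.form) y (vecInChart φ a.vec y) w +
        oneFormInChart φ b.form y (fderiv ℝ (vecInChart φ a.vec) y w) -
        (fderiv ℝ (oneFormInChart φ a.form) y (vecInChart φ b.vec y) w -
          fderiv ℝ (oneFormInChart φ a.form) y w (vecInChart φ b.vec y)) +
        threeFormInChart φ H y ![vecInChart φ b.vec y, vecInChart φ a.vec y, w] := by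
  have hX := ((contDiffOn_vecInChart hφ ha.1).contDiffAt
    (φ.open_target.mem_nhds hy)).differentiableAt (by simp)
  have hC := ((hb.2 φ hφ).contDiffAt (φ.open_target.mem_nhds hy)).differentiableAt (by simp)
  have hev : (fun x : E => b.form x (a.vec x)) ∘ φ.symm =ᶠ[𝓝 y]
      fun z => oneFormInChart φ b.form z (vecInChart φ a.vec z) := by
    filter_upwards [φ.open_target.mem_nhds hy] with z hz
    exact (oneFormInChart_vecInChart hφ b.form a.vec hz).symm
  have hder := (hC.hasFDerivAt.clm_apply hX.hasFDerivAt).congr_of_eventuallyEq hev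
  have h1 := extDerivOneForm_apply hφ hb.2 hy (vecInChart φ a.vec y) w
  have h2 := extDerivOneForm_apply hφ ha.2 hy (vecInChart φ b.vec y) w
  have h3 := mvfderiv_apply_mfderiv_symm hφ hy hder.differentiableAt w
  rw [hder.fderiv] at h3
  rw [mfderiv_symm_vecInChart hφ _ hy] at h1 h2
  have h4 : contractTwice a.vec b.vec H (φ.symm y) (mfderiv (𝓡 N) (𝓡 N) φ.symm y w) =
      threeFormInChart φ H y ![vecInChart φ b.vec y, vecInChart φ a.vec y, w] := by
    have hv : (mfderiv (𝓡 N) (𝓡 N) φ.symm y : EuclideanSpace ℝ (Fin N) → _) ∘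
          ![vecInChart φ b.vec y, vecInChart φ a.vec y, w] =
        Function.update ![b.vec (φ.symm y), a.vec (φ.symm y), 0] 2
          (mfderiv (𝓡 N) (𝓡 N) φ.symm y w) := by
      rw [update_two, ← mfderiv_symm_vecInChart hφ a.vec hy,
        ← mfderiv_symm_vecInChart hφ b.vec hy]
      funext i
      fin_cases i <;> rfl
    exact (congrArg (H (φ.symm y)) hv).symm
  have h5 : oneFormInChart φ (GenSection.dorfman H a b).form y w =
      extDerivOneForm b.form (φ.symm y) (a.vec (φ.symm y)) (mfderiv (𝓡 N) (𝓡 N) φ.symm y w) +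
      mvfderiv (𝓡 N) (fun x : E => b.form x (a.vec x)) (φ.symm y)
        (mfderiv (𝓡 N) (𝓡 N) φ.symm y w) -
      extDerivOneForm a.form (φ.symm y) (b.vec (φ.symm y)) (mfderiv (𝓡 N) (𝓡 N) φ.symm y w) +
      contractTwice a.vec b.vec H (φ.symm y) (mfderiv (𝓡 N) (𝓡 N) φ.symm y w) := rfl
  rw [h5, h1, h2, h3, h4]
  simp only [add_apply, ContinuousLinearMap.comp_apply, ContinuousLinearMap.flip_apply]
  ring

/-- Smoothness follows by currying the first two arguments, because evaluation at the remaining,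
constant one is linear. -/
theorem contDiffOn_threeForm_apply {V : Type*} [NormedAddCommGroup V] [NormedSpace ℝ V]
    {n : ℕ∞ω} {h : V → V [⋀^Fin 3]→L[ℝ] ℝ} {X Y : V → V} {s : Set V}
    (hh : ContDiffOn ℝ n h s) (hX : ContDiffOn ℝ n X s) (hY : ContDiffOn ℝ n Y s) (w : V) :
    ContDiffOn ℝ n (fun y => h y ![X y, Y y, w]) s := by
  have hc (k : ℕ) : ContDiff ℝ n fun f : V [⋀^Fin (k + 1)]→L[ℝ] ℝ => f.curryLeft :=
    LinearIsometry.contDiff (𝕜 := ℝ) (E := V [⋀^Fin (k + 1)]→L[ℝ] ℝ)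
      (F := V →L[ℝ] V [⋀^Fin k]→L[ℝ] ℝ) ContinuousAlternatingMap.curryLeftLI
  have h1 : ContDiffOn ℝ n (fun y => (h y).curryLeft (X y)) s :=
    ((hc 2).comp_contDiffOn hh).clm_apply hX
  have h2 : ContDiffOn ℝ n (fun y => ((h y).curryLeft (X y)).curryLeft (Y y)) s :=
    ((hc 1).comp_contDiffOn h1).clm_apply hY
  exact (ContinuousMultilinearMap.apply ℝ (fun _ : Fin 1 => V) ℝ ![w]).contDiff.comp_contDiffOn
    (ContinuousAlternatingMap.toContinuousMultilinearMapLI.contDiff.comp_contDiffOn h2)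

theorem GenSection.IsSmooth.dorfman [IsManifold (𝓡 N) ∞ E]
    {H : (x : E) → TangentSpace (𝓡 N) x [⋀^Fin 3]→L[ℝ] ℝ} (hH : IsSmoothThreeForm H)
    {a b : GenSection N E} (ha : a.IsSmooth) (hb : b.IsSmooth) :
    (GenSection.dorfman H a b).IsSmooth := by
  refine ⟨contMDiff_mlieBracket ha.1 hb.1, fun φ hφ => contDiffOn_clm_apply.2 fun w => ?_⟩
  refine ContDiffOn.congr ?_ fun y hy => oneFormInChart_dorfman hφ H ha hb hy w
  have ho := φ.open_target
  have hX := contDiffOn_vecInChart hφ ha.1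
  have hY := contDiffOn_vecInChart hφ hb.1
  have hA := ha.2 φ hφ
  have hC := hb.2 φ hφ
  have hX' := hX.fderiv_of_isOpen ho (m := ∞) (by simp)
  have hA' := hA.fderiv_of_isOpen ho (m := ∞) (by simp)
  have hC' := hC.fderiv_of_isOpen ho (m := ∞) (by simp)
  have hw : ContDiffOn ℝ ∞ (fun _ : EuclideanSpace ℝ (Fin N) => w) φ.target := contDiffOn_const
  exact ((((hC'.clm_apply hX).clm_apply hw).add (hC.clm_apply (hX'.clm_apply hw))).sub
    (((hA'.clm_apply hY).clm_apply hw).sub ((hA'.clm_apply hw).clm_apply hY))).add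
    (contDiffOn_threeForm_apply (hH φ hφ) hY hX w)

end Charts

/-! ### The Poisson tensor of the twisted form -/

section Coordinates

variable {N : ℕ}

theorem sum_mul_apply_single (L : EuclideanSpace ℝ (Fin N) →L[ℝ] ℝ)
    (y : EuclideanSpace ℝ (Fin N)) :
    ∑ k, y k * L (EuclideanSpace.single k 1) = L y := by
  conv_rhs => rw [← (EuclideanSpace.basisFun (Fin N) ℝ).sum_repr y, map_sum]
  simp

section Poisson

variable (h : EuclideanSpace ℝ (Fin N) [⋀^Fin 3]→L[ℝ] ℝ) (v : EuclideanSpace ℝ (Fin N))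

theorem sum_mul_threeForm_single (a b y : EuclideanSpace ℝ (Fin N)) :
    ∑ k, y k * h ![a, b, EuclideanSpace.single k 1] = h ![a, b, y] := by
  have h1 := sum_mul_apply_single
    (h.toContinuousMultilinearMap.toContinuousLinearMap ![a, b, 0] 2) y
  have h2 (z : EuclideanSpace ℝ (Fin N)) :
      h.toContinuousMultilinearMap.toContinuousLinearMap ![a, b, 0] 2 z = h ![a, b, z] :=
    congrArg h (update_two a b 0 z)
  simpa only [h2] using h1

theorem threeForm_neg_middle (a b c : EuclideanSpace ℝ (Fin N)) :
    h ![a, -b, c] = -h ![a, b, c] := by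
  have h1 := h.map_update_neg ![a, 0, c] 1 b
  rw [update_one, update_one] at h1
  exact h1

theorem threeForm_cyclic (a b c : EuclideanSpace ℝ (Fin N)) : h ![a, b, c] = h ![b, c, a] := by
  have h1 := h.toAlternatingMap.map_swap ![a, b, c] (i := 0) (j := 1) (by decide)
  have h2 := h.toAlternatingMap.map_swap ![b, a, c] (i := 1) (j := 2) (by decide)
  have e1 : (![a, b, c] ∘ Equiv.swap (0 : Fin 3) 1) = ![b, a, c] := by
    ext i
    fin_cases i <;> rfl
  have e2 : (![b, a, c] ∘ Equiv.swap (1 : Fin 3) 2) = ![b, c, a] := by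
    ext i
    fin_cases i <;> rfl
  rw [e1] at h1
  rw [e2] at h2
  change h ![b, a, c] = -h ![a, b, c] at h1
  change h ![b, c, a] = -h ![b, a, c] at h2
  rw [h2, h1, neg_neg]

theorem twistedForm_hamiltonian (i : Idx N) (Z : Idx N → ℝ) :
    twistedForm h v (hamiltonian h v i) Z = Z i :=
  (twistedForm h v).apply_toDual_symm_apply (hB := twistedForm_nondegenerate h v)
    (LinearMap.proj i : (Idx N → ℝ) →ₗ[ℝ] ℝ) Z

theorem hamiltonian_eq_of_forall {i : Idx N} {Y : Idx N → ℝ}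
    (hY : ∀ Z, twistedForm h v Y Z = Z i) : hamiltonian h v i = Y := by
  have := (twistedForm_nondegenerate h v).1 (hamiltonian h v i - Y) fun Z => by
    rw [map_sub, LinearMap.sub_apply, twistedForm_hamiltonian, hY, sub_self]
  exact sub_eq_zero.1 this

theorem position_single_inr (i : Fin N) :
    position (Pi.single (Sum.inr i) 1 : Idx N → ℝ) = 0 := by
  ext k
  simp [position]

theorem hamiltonian_inl (i : Fin N) :
    hamiltonian h v (Sum.inl i) = Pi.single (Sum.inr i) 1 := by
  refine hamiltonian_eq_of_forall h v fun Z => ?_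
  have h3 := h.map_coord_zero (m := ![v, 0, position Z]) 1 rfl
  rw [twistedForm_apply, position_single_inr, h3]
  simp [Pi.single_apply]

theorem hamiltonian_inr (i : Fin N) :
    hamiltonian h v (Sum.inr i) = Sum.elim (fun k => -(if k = i then 1 else 0))
      (fun k => h ![v, EuclideanSpace.single i 1, EuclideanSpace.single k 1]) := by
  refine hamiltonian_eq_of_forall h v fun Z => ?_
  have h1 : position (Sum.elim (fun k => -(if k = i then 1 else 0))
      (fun k => h ![v, EuclideanSpace.single i 1, EuclideanSpace.single k 1])) =
      -EuclideanSpace.single i (1 : ℝ) := by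
    ext k
    simp [position]
  rw [twistedForm_apply, h1, threeForm_neg_middle, ← sum_mul_threeForm_single, ← sub_eq_add_neg,
    ← Finset.sum_sub_distrib]
  rw [Finset.sum_congr rfl (g := fun k => if k = i then Z (Sum.inr k) else 0)]
  · simp
  · intro k _
    simp only [Sum.elim_inl, Sum.elim_inr, position]
    split_ifs <;> ring

variable (ε : ℝ) (η : EuclideanSpace ℝ (Fin N) → EuclideanSpace ℝ (Fin N) [⋀^Fin 3]→L[ℝ] ℝ)
  (i j : Fin N) (u : Jet N)

theorem poissonTensor_inl_inl : poissonTensor ε η (Sum.inl i) (Sum.inl j) u = 0 := by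
  rw [poissonTensor, twistedForm_hamiltonian, hamiltonian_inl]
  simp

theorem poissonTensor_inl_inr :
    poissonTensor ε η (Sum.inl i) (Sum.inr j) u = if i = j then -ε else 0 := by
  rw [poissonTensor, twistedForm_hamiltonian, hamiltonian_inr]
  simp only [Sum.elim_inl]
  split_ifs <;> simp

theorem poissonTensor_inr_inl :
    poissonTensor ε η (Sum.inr i) (Sum.inl j) u = if i = j then ε else 0 := by
  rw [poissonTensor, twistedForm_hamiltonian, hamiltonian_inl]
  simp [Pi.single_apply]

theorem poissonTensor_inr_inr :
    poissonTensor ε η (Sum.inr i) (Sum.inr j) u =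
      ε * η (position (u 0)) ![position (u 1), EuclideanSpace.single j 1,
        EuclideanSpace.single i 1] := by
  rw [poissonTensor, twistedForm_hamiltonian, hamiltonian_inr]
  rfl

end Poisson

/-! ### Locality of the operations on functions of jets -/

/-- The jets of curves whose position lies in `s`. If `s` is open, a small change of one jet
coordinate does not leave this set, so that the operations of the calculus of local functions respect
equality of functions on it. -/
def jetsOver (s : Set (EuclideanSpace ℝ (Fin N))) : Set (Jet N) := {u | position (u 0) ∈ s}

theorem continuous_position : Continuous (position : (Idx N → ℝ) → EuclideanSpace ℝ (Fin N)) :=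
  (PiLp.continuous_toLp 2 _).comp (continuous_pi fun i => continuous_apply (Sum.inl i))

section Congr

variable {s : Set (EuclideanSpace ℝ (Fin N))} {f f' g g' : Jet N → ℝ}

theorem eventually_update_mem_jetsOver (hs : IsOpen s) {u : Jet N} (hu : u ∈ jetsOver s)
    (i : Idx N) (m : ℕ) :
    ∀ᶠ r in 𝓝 (u m i), Function.update u m (Function.update (u m) i r) ∈ jetsOver s := by
  have hc : Continuous fun r : ℝ =>
      position (Function.update u m (Function.update (u m) i r) 0) :=
    continuous_position.comp <| (continuous_apply 0).comp <|
      continuous_const.update m (continuous_const (y := u m) |>.update i continuous_id)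
  refine hc.continuousAt.eventually (hs.mem_nhds ?_)
  simp only [Function.update_eq_self]
  exact hu

theorem partialD_congr (hs : IsOpen s) (h : Set.EqOn f g (jetsOver s)) (i : Idx N) (m : ℕ) :
    Set.EqOn (partialD i m f) (partialD i m g) (jetsOver s) := fun _ hu =>
  Filter.EventuallyEq.deriv_eq ((eventually_update_mem_jetsOver hs hu i m).mono fun _ hr => h hr)

theorem totalD_congr (hs : IsOpen s) (h : Set.EqOn f g (jetsOver s)) :
    Set.EqOn (totalD f) (totalD g) (jetsOver s) := fun u hu =>
  finsum_congr fun q => by rw [partialD_congr hs h q.1 q.2 hu]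

theorem shiftD_congr (hs : IsOpen s) (l : ℝ) (h : Set.EqOn f g (jetsOver s)) :
    Set.EqOn (shiftD l f) (shiftD l g) (jetsOver s) := fun u hu => by
  rw [shiftD, shiftD, totalD_congr hs h hu, h hu]

theorem negShiftD_congr (hs : IsOpen s) (l : ℝ) (h : Set.EqOn f g (jetsOver s)) :
    Set.EqOn (negShiftD l f) (negShiftD l g) (jetsOver s) := fun u hu => by
  rw [negShiftD, negShiftD, shiftD_congr hs l h hu]

theorem shiftD_iterate_congr (hs : IsOpen s) (l : ℝ) (n : ℕ) (h : Set.EqOn f g (jetsOver s)) :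
    Set.EqOn ((shiftD l)^[n] f) ((shiftD l)^[n] g) (jetsOver s) := by
  induction n generalizing f g with
  | zero => exact h
  | succ n ih => exact ih (shiftD_congr hs l h)

theorem negShiftD_iterate_congr (hs : IsOpen s) (l : ℝ) (n : ℕ)
    (h : Set.EqOn f g (jetsOver s)) :
    Set.EqOn ((negShiftD l)^[n] f) ((negShiftD l)^[n] g) (jetsOver s) := by
  induction n generalizing f g with
  | zero => exact h
  | succ n ih => exact ih (negShiftD_congr hs l h)

theorem lambdaBracket_congr (hs : IsOpen s) (B : Idx N → Idx N → Jet N → ℝ) (l : ℝ)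
    (hf : Set.EqOn f f' (jetsOver s)) (hg : Set.EqOn g g' (jetsOver s)) :
    Set.EqOn (lambdaBracket B l f g) (lambdaBracket B l f' g') (jetsOver s) := fun u hu =>
  finsum_congr fun q => by
    rw [partialD_congr hs hg q.2.1 q.2.2 hu]
    congr 1
    refine shiftD_iterate_congr hs l q.2.2 (fun w hw => ?_) hu
    rw [negShiftD_iterate_congr hs l q.1.2 (partialD_congr hs hf q.1.1 q.1.2) hw]

end Congr

theorem partialD_zero (i : Idx N) (m : ℕ) : partialD i m (0 : Jet N → ℝ) = 0 :=
  funext fun u => deriv_const (u m i) (0 : ℝ)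

theorem shiftD_zero (l : ℝ) : shiftD l (0 : Jet N → ℝ) = 0 := by
  funext u
  simp [shiftD, totalD, partialD_zero]

theorem negShiftD_zero (l : ℝ) : negShiftD l (0 : Jet N → ℝ) = 0 := by
  funext u
  simp [negShiftD, shiftD_zero]

theorem shiftD_iterate_zero (l : ℝ) (n : ℕ) : (shiftD l)^[n] (0 : Jet N → ℝ) = 0 :=
  Function.iterate_fixed (shiftD_zero l) n

theorem negShiftD_iterate_zero (l : ℝ) (n : ℕ) : (negShiftD l)^[n] (0 : Jet N → ℝ) = 0 :=
  Function.iterate_fixed (negShiftD_zero l) n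

/-! ### The `λ`-bracket of currents in Darboux coordinates -/

/-- The current `A_x(∂x) + p(X)` of a one-form `A` and a vector field `X` on a domain of `ℝᴺ`, as a
function on jets: the expression of an Alekseev-Strobl function in a chart. -/
def current (A : EuclideanSpace ℝ (Fin N) → EuclideanSpace ℝ (Fin N) →L[ℝ] ℝ)
    (X : EuclideanSpace ℝ (Fin N) → EuclideanSpace ℝ (Fin N)) (u : Jet N) : ℝ :=
  A (position (u 0)) (position (u 1)) + ∑ k, u 0 (Sum.inr k) * X (position (u 0)) k

theorem position_update_inl (w : Idx N → ℝ) (i : Fin N) (r : ℝ) :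
    position (Function.update w (Sum.inl i) r) =
      position w + (r - w (Sum.inl i)) • EuclideanSpace.single i (1 : ℝ) := by
  ext k
  rcases eq_or_ne k i with rfl | hk
  · simp [position]
  · simp [position, Function.update_of_ne, hk]

theorem position_update_inr (w : Idx N → ℝ) (i : Fin N) (r : ℝ) :
    position (Function.update w (Sum.inr i) r) = position w := by
  ext k
  simp [position]

theorem hasDerivAt_position_update (w : Idx N → ℝ) (i : Fin N) :
    HasDerivAt (fun r => position (Function.update w (Sum.inl i) r))
      (EuclideanSpace.single i (1 : ℝ)) (w (Sum.inl i)) := by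
  simp only [position_update_inl]
  simpa using ((((hasDerivAt_id (w (Sum.inl i))).sub_const (w (Sum.inl i))).smul_const
    (EuclideanSpace.single i (1 : ℝ))).const_add (position w))

/-- The chain rule along a coordinate line, for a function of the position. -/
theorem hasDerivAt_comp_position_update {F : Type*} [NormedAddCommGroup F]
    [NormedSpace ℝ F] {f : EuclideanSpace ℝ (Fin N) → F} {f' : EuclideanSpace ℝ (Fin N) →L[ℝ] F}
    {w : Idx N → ℝ} (hf : HasFDerivAt f f' (position w)) (i : Fin N) :
    HasDerivAt (fun r => f (position (Function.update w (Sum.inl i) r)))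
      (f' (EuclideanSpace.single i 1)) (w (Sum.inl i)) := by
  refine HasFDerivAt.comp_hasDerivAt (f := fun r => position (Function.update w (Sum.inl i) r))
    _ ?_ (hasDerivAt_position_update w i)
  simpa using hf

section Current

variable {A C : EuclideanSpace ℝ (Fin N) → EuclideanSpace ℝ (Fin N) →L[ℝ] ℝ}
  {X Y : EuclideanSpace ℝ (Fin N) → EuclideanSpace ℝ (Fin N)}

theorem partialD_current_position {u : Jet N} (hA : DifferentiableAt ℝ A (position (u 0)))
    (hX : DifferentiableAt ℝ X (position (u 0))) (i : Fin N) :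
    partialD (Sum.inl i) 0 (current A X) u =
      fderiv ℝ A (position (u 0)) (EuclideanSpace.single i 1) (position (u 1)) +
        ∑ k, u 0 (Sum.inr k) * fderiv ℝ X (position (u 0)) (EuclideanSpace.single i 1) k := by
  have h1 := (hasDerivAt_comp_position_update hA.hasFDerivAt i).clm_apply
    (hasDerivAt_const _ (position (u 1)))
  have h2 (k : Fin N) : HasDerivAt
      (fun r => X (position (Function.update (u 0) (Sum.inl i) r)) k)
      (fderiv ℝ X (position (u 0)) (EuclideanSpace.single i 1) k) (u 0 (Sum.inl i)) :=
    (EuclideanSpace.proj (𝕜 := ℝ) k).hasFDerivAt.comp_hasDerivAt _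
      (hasDerivAt_comp_position_update hX.hasFDerivAt i)
  have h3 := h1.add (HasDerivAt.fun_sum (u := Finset.univ) fun k _ =>
    (h2 k).const_mul (u 0 (Sum.inr k)))
  simp only [map_zero, add_zero] at h3
  rw [partialD, ← h3.deriv]
  rfl

theorem partialD_current_velocity (i : Fin N) (u : Jet N) :
    partialD (Sum.inl i) 1 (current A X) u =
      A (position (u 0)) (EuclideanSpace.single i 1) := by
  have h1 := ((A (position (u 0))).hasFDerivAt.comp_hasDerivAt _
    (hasDerivAt_position_update (u 1) i)).add_const
      (∑ k, u 0 (Sum.inr k) * X (position (u 0)) k)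
  rw [partialD, ← h1.deriv]
  rfl

theorem partialD_current_momentum (i : Fin N) (u : Jet N) :
    partialD (Sum.inr i) 0 (current A X) u = X (position (u 0)) i := by
  have h1 (k : Fin N) : HasDerivAt
      (fun r => Function.update (u 0) (Sum.inr i) r (Sum.inr k)) (if k = i then 1 else 0)
      (u 0 (Sum.inr i)) := by
    rcases eq_or_ne k i with rfl | hk
    · simpa using! hasDerivAt_id _
    · simpa [Function.update_of_ne, hk] using hasDerivAt_const (u 0 (Sum.inr i)) (u 0 (Sum.inr k))
  have h2 := (HasDerivAt.fun_sum (u := Finset.univ) fun k _ =>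
    (h1 k).mul_const (X (position (u 0)) k)).const_add (A (position (u 0)) (position (u 1)))
  simp only [ite_mul, one_mul, zero_mul, Finset.sum_ite_eq', Finset.mem_univ, if_true] at h2
  rw [partialD, ← h2.deriv]
  rfl

theorem partialD_current_momentum_one (i : Fin N) :
    partialD (Sum.inr i) 1 (current A X) = 0 := by
  funext u
  simp [partialD, current, position_update_inr]

theorem partialD_current_of_two_le (i : Idx N) {m : ℕ} (hm : 2 ≤ m) :
    partialD i m (current A X) = 0 := by
  funext u
  have h0 : (0 : ℕ) ≠ m := by lia
  have h1 : (1 : ℕ) ≠ m := by lia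
  simp [partialD, current, Function.update_of_ne, h0, h1]

/-- The chain rule for the total derivative of a function of the position. -/
theorem totalD_position {F : EuclideanSpace ℝ (Fin N) → ℝ} {u : Jet N}
    (hF : DifferentiableAt ℝ F (position (u 0))) :
    totalD (fun w => F (position (w 0))) u = fderiv ℝ F (position (u 0)) (position (u 1)) := by
  have hx (i : Fin N) : partialD (Sum.inl i) 0 (fun w => F (position (w 0))) u =
      fderiv ℝ F (position (u 0)) (EuclideanSpace.single i 1) := by
    rw [partialD, ← (hasDerivAt_comp_position_update hF.hasFDerivAt i).deriv]
    simp
  have hp (i : Fin N) : partialD (Sum.inr i) 0 (fun w => F (position (w 0))) u = 0 := by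
    simp [partialD, position_update_inr]
  have hm (i : Idx N) {m : ℕ} (hm : m ≠ 0) :
      partialD i m (fun w => F (position (w 0))) u = 0 := by
    simp [partialD, Function.update_of_ne hm.symm]
  rw [totalD, finsum_eq_sum_of_support_subset (s := Finset.univ ×ˢ {0})]
  · rw [Finset.sum_product, Fintype.sum_sum_type, ← sum_mul_apply_single]
    simp [hx, hp]
    rfl
  · intro q hq
    simp only [Finset.coe_product, Finset.coe_univ, Finset.coe_singleton, Set.mem_prod,
      Set.mem_univ, Set.mem_singleton_iff, true_and]
    by_contra h0
    exact hq (by simp [hm q.1 h0])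

/-- A current depends on the jet of order one only, so the sum in the `λ`-bracket is finite. -/
theorem lambdaBracket_current_eq_sum (B : Idx N → Idx N → Jet N → ℝ) (l : ℝ) (u : Jet N) :
    lambdaBracket B l (current A X) (current C Y) u =
      ∑ q ∈ ((Finset.univ : Finset (Idx N)) ×ˢ Finset.range 2) ×ˢ
        ((Finset.univ : Finset (Idx N)) ×ˢ Finset.range 2),
        partialD q.2.1 q.2.2 (current C Y) u *
          ((shiftD l)^[q.2.2] (fun w => B q.1.1 q.2.1 w *
            ((negShiftD l)^[q.1.2] (partialD q.1.1 q.1.2 (current A X))) w)) u := by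
  refine finsum_eq_sum_of_support_subset _ fun q hq => ?_
  simp only [Finset.coe_product, Finset.coe_univ, Finset.coe_range, Set.mem_prod, Set.mem_univ,
    Set.mem_Iio, true_and]
  by_contra hlt
  refine hq ?_
  rcases not_and_or.1 hlt with h1 | h1
  · have h2 : (fun w => B q.1.1 q.2.1 w *
        ((negShiftD l)^[q.1.2] (partialD q.1.1 q.1.2 (current A X))) w) = 0 := by
      funext w
      rw [partialD_current_of_two_le q.1.1 (not_lt.1 h1), negShiftD_iterate_zero]
      exact mul_zero _
    change _ * _ = _
    rw [h2, shiftD_iterate_zero]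
    exact mul_zero _
  · change _ * _ = _
    rw [partialD_current_of_two_le q.2.1 (not_lt.1 h1)]
    exact zero_mul _

/-- The `λ`-bracket of two currents, in coordinates. Only the derivatives by `x`, `∂x` and `p`
contribute, and `λ` enters through the derivatives by `∂x` alone. Since those meet only the constant
entries `Bₓₚ` and `Bₚₓ` of the Poisson tensor, and `Bₓₓ = 0`, the bracket is affine in `λ`; the
three-form enters through `Bₚₚ` and the derivatives by `p`. -/
theorem lambdaBracket_current (ε l : ℝ)
    (η : EuclideanSpace ℝ (Fin N) → EuclideanSpace ℝ (Fin N) [⋀^Fin 3]→L[ℝ] ℝ) {u : Jet N}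
    (hA : DifferentiableAt ℝ A (position (u 0))) (hC : DifferentiableAt ℝ C (position (u 0)))
    (hX : DifferentiableAt ℝ X (position (u 0))) (hY : DifferentiableAt ℝ Y (position (u 0))) :
    lambdaBracket (poissonTensor ε η) l (current A X) (current C Y) u =
      ε * (fderiv ℝ C (position (u 0)) (X (position (u 0))) (position (u 1)) +
        C (position (u 0)) (fderiv ℝ X (position (u 0)) (position (u 1))) -
        (fderiv ℝ A (position (u 0)) (Y (position (u 0))) (position (u 1)) -
          fderiv ℝ A (position (u 0)) (position (u 1)) (Y (position (u 0)))) +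
        η (position (u 0)) ![Y (position (u 0)), X (position (u 0)), position (u 1)] +
        ∑ k, u 0 (Sum.inr k) *
          (fderiv ℝ Y (position (u 0)) (X (position (u 0))) -
            fderiv ℝ X (position (u 0)) (Y (position (u 0)))) k) +
      l * (ε * (A (position (u 0)) (Y (position (u 0))) +
        C (position (u 0)) (X (position (u 0))))) := by
  set x := position (u 0) with hx
  set v := position (u 1) with hv
  -- `T i m j n` is the summand of the `λ`-bracket for `∂f/∂uᵢ⁽ᵐ⁾` and `∂g/∂uⱼ⁽ⁿ⁾`, and `P Z w` is the
  -- pairing of the momentum with the derivative of the vector field `Z` along `w`.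
  let T (i : Idx N) (m : ℕ) (j : Idx N) (n : ℕ) : ℝ :=
    partialD j n (current C Y) u * ((shiftD l)^[n] (fun w => poissonTensor ε η i j w *
      ((negShiftD l)^[m] (partialD i m (current A X))) w)) u
  let P (Z : EuclideanSpace ℝ (Fin N) → EuclideanSpace ℝ (Fin N)) :
      EuclideanSpace ℝ (Fin N) →L[ℝ] ℝ :=
    ∑ k, u 0 (Sum.inr k) • (EuclideanSpace.proj (𝕜 := ℝ) k).comp (fderiv ℝ Z x)
  have hP (Z : EuclideanSpace ℝ (Fin N) → EuclideanSpace ℝ (Fin N))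
      (w : EuclideanSpace ℝ (Fin N)) : ∑ k, u 0 (Sum.inr k) * fderiv ℝ Z x w k = P Z w := by
    simp [P, sum_apply]
  have hsum : lambdaBracket (poissonTensor ε η) l (current A X) (current C Y) u =
      ∑ i, ∑ m ∈ Finset.range 2, ∑ j, ∑ n ∈ Finset.range 2, T i m j n := by
    rw [lambdaBracket_current_eq_sum, Finset.sum_product, Finset.sum_product]
    simp only [Finset.sum_product]
    rfl
  have t1 (i j : Fin N) (m n : ℕ) : T (Sum.inl i) m (Sum.inl j) n = 0 := by
    have h0 : (fun w => poissonTensor ε η (Sum.inl i) (Sum.inl j) w *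
        ((negShiftD l)^[m] (partialD (Sum.inl i) m (current A X))) w) = 0 := by
      funext w
      simp [poissonTensor_inl_inl]
    simp only [T, h0, shiftD_iterate_zero]
    exact mul_zero _
  have t2 (i : Fin N) (j : Idx N) (n : ℕ) : T (Sum.inr i) 1 j n = 0 := by
    have h0 : (fun w => poissonTensor ε η (Sum.inr i) j w *
        ((negShiftD l)^[1] (partialD (Sum.inr i) 1 (current A X))) w) = 0 := by
      funext w
      simp [partialD_current_momentum_one, negShiftD_zero]
    simp only [T, h0, shiftD_iterate_zero]
    exact mul_zero _
  have t3 (i : Idx N) (m : ℕ) (j : Fin N) : T i m (Sum.inr j) 1 = 0 := by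
    simp [T, partialD_current_momentum_one]
  have t4 (i j : Fin N) : T (Sum.inr i) 0 (Sum.inl j) 0 =
      if i = j then ε * X x i * (fderiv ℝ C x (EuclideanSpace.single i 1) v +
        P Y (EuclideanSpace.single i 1)) else 0 := by
    simp only [T, Function.iterate_zero, id_eq, poissonTensor_inr_inl,
      partialD_current_momentum, partialD_current_position hC hY, hP, ← hx, ← hv]
    split_ifs with hij
    · rw [hij]
      ring
    · ring
  have t5 (i j : Fin N) : T (Sum.inr i) 0 (Sum.inl j) 1 =
      if i = j then ε * C x (EuclideanSpace.single i 1) *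
        (fderiv ℝ X x v i + l * X x i) else 0 := by
    have hXi : HasFDerivAt (fun y => X y i)
        ((EuclideanSpace.proj (𝕜 := ℝ) i).comp (fderiv ℝ X x)) x :=
      (EuclideanSpace.proj (𝕜 := ℝ) i).hasFDerivAt.comp x hX.hasFDerivAt
    have hd : HasFDerivAt (fun y => (if i = j then ε else 0) * X y i) _ x :=
      hXi.const_mul (if i = j then ε else 0)
    have htot := totalD_position (u := u) hd.differentiableAt
    rw [← hx, ← hv, hd.fderiv] at htot
    simp only [T, Function.iterate_zero, Function.iterate_one, id_eq, poissonTensor_inr_inl,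
      partialD_current_momentum, partialD_current_velocity, shiftD, htot, ← hx]
    split_ifs with hij
    · rw [hij]
      simp
      ring
    · simp
  have t6 (i j : Fin N) : T (Sum.inl i) 0 (Sum.inr j) 0 =
      if i = j then -ε * Y x i * (fderiv ℝ A x (EuclideanSpace.single i 1) v +
        P X (EuclideanSpace.single i 1)) else 0 := by
    simp only [T, Function.iterate_zero, id_eq, poissonTensor_inl_inr,
      partialD_current_momentum, partialD_current_position hA hX, hP, ← hx, ← hv]
    split_ifs with hij
    · rw [hij]
      ring
    · ring
  have t7 (i j : Fin N) : T (Sum.inl i) 1 (Sum.inr j) 0 =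
      if i = j then ε * Y x i * (fderiv ℝ A x v (EuclideanSpace.single i 1) +
        l * A x (EuclideanSpace.single i 1)) else 0 := by
    have hd := hA.hasFDerivAt.clm_apply
      (hasFDerivAt_const (EuclideanSpace.single i (1 : ℝ) : EuclideanSpace ℝ (Fin N)) x)
    have htot := totalD_position (u := u) hd.differentiableAt
    rw [← hx, ← hv, hd.fderiv] at htot
    have hfun : partialD (Sum.inl i) 1 (current A X) =
        fun w => A (position (w 0)) (EuclideanSpace.single i 1) :=
      funext (partialD_current_velocity i)
    simp only [T, Function.iterate_zero, Function.iterate_one, id_eq, poissonTensor_inl_inr,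
      partialD_current_momentum, hfun, negShiftD, shiftD, htot, ← hx]
    split_ifs with hij
    · rw [hij]
      simp
      ring
    · simp
  have t8 (i j : Fin N) : T (Sum.inr i) 0 (Sum.inr j) 0 =
      ε * X x i * (Y x j * η x ![v, EuclideanSpace.single j 1, EuclideanSpace.single i 1]) := by
    simp only [T, Function.iterate_zero, id_eq, poissonTensor_inr_inr,
      partialD_current_momentum, ← hx, ← hv]
    ring
  have hη : ∑ i, X x i * ∑ j, Y x j *
      η x ![v, EuclideanSpace.single j 1, EuclideanSpace.single i 1] = η x ![Y x, X x, v] := by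
    have h1 (i : Fin N) : ∑ j, Y x j *
        η x ![v, EuclideanSpace.single j 1, EuclideanSpace.single i 1] =
        η x ![v, Y x, EuclideanSpace.single i 1] := by
      rw [threeForm_cyclic (η x) v (Y x), threeForm_cyclic (η x) (Y x),
        ← sum_mul_threeForm_single]
      refine Finset.sum_congr rfl fun j _ => ?_
      rw [threeForm_cyclic (η x) v, threeForm_cyclic (η x) _ _ v]
    simp only [h1, sum_mul_threeForm_single]
    exact threeForm_cyclic (η x) _ _ _
  have e1 := sum_mul_apply_single ((fderiv ℝ C x).flip v) (X x)
  have e2 := sum_mul_apply_single (P Y) (X x)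
  have e3 := sum_mul_apply_single (C x) (fderiv ℝ X x v)
  have e4 := sum_mul_apply_single (C x) (X x)
  have e5 := sum_mul_apply_single ((fderiv ℝ A x).flip v) (Y x)
  have e6 := sum_mul_apply_single (P X) (Y x)
  have e7 := sum_mul_apply_single (fderiv ℝ A x v) (Y x)
  have e8 := sum_mul_apply_single (A x) (Y x)
  simp only [ContinuousLinearMap.flip_apply] at e1 e5
  have hPs : ∑ k, u 0 (Sum.inr k) * (fderiv ℝ Y x (X x) - fderiv ℝ X x (Y x)) k =
      P Y (X x) - P X (Y x) := by
    rw [← hP, ← hP, ← Finset.sum_sub_distrib]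
    exact Finset.sum_congr rfl fun k _ => mul_sub _ _ _
  rw [hsum, hPs, ← hη, ← e1, ← e2, ← e3, ← e4, ← e5, ← e6, ← e7, ← e8]
  simp only [Fintype.sum_sum_type, Finset.sum_range_succ, Finset.range_zero, Finset.sum_empty,
    zero_add, t1, t2, t3, t4, t5, t6, t7, t8, Finset.sum_add_distrib, Finset.sum_ite_eq,
    Finset.mem_univ, if_true, Finset.sum_const_zero, add_zero, ← Finset.mul_sum]
  simp only [Finset.mul_sum, ← Finset.sum_add_distrib, ← Finset.sum_sub_distrib]
  refine Finset.sum_congr rfl fun i _ => ?_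
  simp only [← Finset.mul_sum]
  ring

end Current

end Coordinates

/-! ### Realisation of jets by loops -/

section Loops

variable {N : ℕ} {E : Type*} [TopologicalSpace E] [ChartedSpace (EuclideanSpace ℝ (Fin N)) E]

/-- A smooth periodic reparametrisation with small range that is the identity near `0`: composed
with it, the germ of a curve becomes a loop with the same jets that stays in a small set. -/
theorem exists_periodic_eventuallyEq_id {δ : ℝ} (hδ : 0 < δ) :
    ∃ h : ℝ → ℝ, ContDiff ℝ ∞ h ∧ Function.Periodic h 1 ∧ h =ᶠ[𝓝 0] id ∧ ∀ s, |h s| < δ := by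
  have hπ : 0 < 2 * Real.pi := by positivity
  have hcont : ∀ᶠ y in 𝓝 (0 : ℝ), |Real.arcsin y / (2 * Real.pi)| < δ := by
    have hc : Continuous fun y => |Real.arcsin y / (2 * Real.pi)| :=
      (Real.continuous_arcsin.div_const _).abs
    refine hc.continuousAt.eventually_lt continuousAt_const ?_
    simpa using hδ
  obtain ⟨r, hr, hball⟩ := Metric.eventually_nhds_iff_ball.1 hcont
  -- The function is `arcsin (sin 2πs) / 2π`, cut off where `sin 2πs` leaves a small interval around
  -- `0`; the radius `ρ ≤ 1/2` keeps the argument of `arcsin` away from `±1`.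
  set ρ := min r (1 / 2)
  have hρ : 0 < ρ := lt_min hr (by norm_num)
  let b : ContDiffBump (0 : ℝ) := ⟨ρ / 2, ρ, by positivity, by linarith⟩
  let G : ℝ → ℝ := fun y => b y * (Real.arcsin y / (2 * Real.pi))
  have hG : ContDiff ℝ ∞ G := by
    refine contDiff_iff_contDiffAt.2 fun y => ?_
    rcases lt_or_ge |y| 1 with hy | hy
    · obtain ⟨h1, h2⟩ := abs_lt.1 hy
      exact b.contDiffAt.mul ((Real.contDiffAt_arcsin h1.ne' h2.ne).div_const _)
    · have hy' : y ∉ tsupport b := by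
        rw [b.tsupport_eq, Metric.mem_closedBall, dist_zero_right, Real.norm_eq_abs, not_le]
        exact (min_le_right r (1 / 2)).trans_lt (by linarith)
      have h0 : G =ᶠ[𝓝 y] fun _ => 0 := by
        filter_upwards [notMem_tsupport_iff_eventuallyEq.1 hy'] with z hz
        simp [G, hz]
      exact contDiffAt_const.congr_of_eventuallyEq h0
  have hlt (y : ℝ) : |G y| < δ := by
    rcases lt_or_ge |y| ρ with hy | hy
    · refine lt_of_le_of_lt ?_ (hball y ?_)
      · rw [abs_mul, abs_of_nonneg b.nonneg]
        exact mul_le_of_le_one_left (abs_nonneg _) b.le_one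
      · rw [mem_ball_zero_iff, Real.norm_eq_abs]
        exact hy.trans_le (min_le_left _ _)
    · have hb : b y = 0 := b.zero_of_le_dist (by simpa [b] using hy)
      simpa [G, hb] using hδ
  refine ⟨fun s => G (Real.sin (2 * Real.pi * s)),
    hG.comp (Real.contDiff_sin.comp (contDiff_const.mul contDiff_id)), fun s => ?_, ?_,
    fun s => ?_⟩
  · change G _ = G _
    rw [mul_add, mul_one, Real.sin_add_two_pi]
  · have hs : Continuous fun s : ℝ => |Real.sin (2 * Real.pi * s)| := by fun_prop
    have h1 : ∀ᶠ s in 𝓝 (0 : ℝ), |Real.sin (2 * Real.pi * s)| < ρ / 2 :=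
      hs.continuousAt.eventually_lt continuousAt_const (by simpa using hρ)
    have hs' : Continuous fun s : ℝ => |2 * Real.pi * s| := by fun_prop
    have h2 : ∀ᶠ s in 𝓝 (0 : ℝ), |2 * Real.pi * s| < Real.pi / 2 :=
      hs'.continuousAt.eventually_lt continuousAt_const (by simpa using Real.pi_pos)
    filter_upwards [h1, h2] with s hs1 hs2
    obtain ⟨h3, h4⟩ := abs_lt.1 hs2
    have hb : b (Real.sin (2 * Real.pi * s)) = 1 := b.one_of_mem_closedBall (by
      rw [Metric.mem_closedBall, dist_zero_right, Real.norm_eq_abs]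
      exact hs1.le)
    simp only [G, hb, one_mul, id_eq]
    rw [Real.arcsin_sin (by linarith) h4.le]
    field_simp
  · exact hlt _

theorem iteratedDeriv_taylor_polynomial (a : ℕ → ℝ) {k m : ℕ} (hm : m ≤ k) :
    iteratedDeriv m (fun s : ℝ => ∑ r ∈ Finset.range (k + 1), a r / r.factorial * s ^ r) 0 =
      a m := by
  rw [iteratedDeriv_fun_sum fun r _ => (contDiff_const.mul (contDiff_id.pow r)).contDiffAt]
  simp only [iteratedDeriv_const_mul_field, iteratedDeriv_fun_pow_zero]
  rw [Finset.sum_eq_single m (fun r _ hr => by simp [hr.symm])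
    (fun h => absurd (Finset.mem_range.2 (by lia)) h)]
  have := m.factorial_ne_zero
  simp [this]

/-- Every jet of finite order over an open set `s` is the jet of a loop that stays over `s`: the
Taylor polynomial composed with a small periodic reparametrisation. -/
theorem exists_loop_of_jet {s : Set (EuclideanSpace ℝ (Fin N))} (hs : IsOpen s) {u : Jet N}
    (hu : u ∈ jetsOver s) (k : ℕ) :
    ∃ q : ℝ → Idx N → ℝ, ContDiff ℝ ∞ q ∧ Function.Periodic q 1 ∧ (∀ t, position (q t) ∈ s) ∧
      ∀ m ≤ k, ∀ i, iteratedDeriv m (fun t => q t i) 0 = u m i := by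
  let P : ℝ → Idx N → ℝ := fun t i =>
    ∑ r ∈ Finset.range (k + 1), u r i / r.factorial * t ^ r
  have hP : ContDiff ℝ ∞ P := contDiff_pi.2 fun i =>
    ContDiff.sum fun r _ => contDiff_const.mul (contDiff_id.pow r)
  have hP0 : P 0 = u 0 := by
    funext i
    simp [P, Finset.sum_range_succ']
  have hmem : ∀ᶠ t in 𝓝 (0 : ℝ), position (P t) ∈ s :=
    (continuous_position.comp hP.continuous).continuousAt.eventually
      (hs.mem_nhds (by simpa [hP0] using! hu))
  obtain ⟨δ, hδ, hball⟩ := Metric.eventually_nhds_iff_ball.1 hmem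
  obtain ⟨h, hh, hper, hid, hsmall⟩ := exists_periodic_eventuallyEq_id hδ
  refine ⟨fun t => P (h t), hP.comp hh, fun t => congrArg P (hper t),
    fun t => hball _ (by simpa using hsmall t), fun m hm i => ?_⟩
  have hev : (fun t => P (h t) i) =ᶠ[𝓝 0] fun t => P t i :=
    hid.mono fun t ht => congrArg (fun r => P r i) ht
  rw [hev.iteratedDeriv_eq]
  exact iteratedDeriv_taylor_polynomial (fun r => u r i) hm

/-- The covector at `x` whose momentum coordinates in the chart `φ` are `p`. -/
def covectorOfCoord (φ : OpenPartialHomeomorph E (EuclideanSpace ℝ (Fin N))) (x : E)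
    (p : Fin N → ℝ) : TangentSpace (𝓡 N) x →L[ℝ] ℝ :=
  (∑ k, p k • (EuclideanSpace.proj k : EuclideanSpace ℝ (Fin N) →L[ℝ] ℝ)).comp
    (mfderiv (𝓡 N) (𝓡 N) φ x)

variable {φ : OpenPartialHomeomorph E (EuclideanSpace ℝ (Fin N))}

theorem isInvertible_mfderiv (hφ : φ ∈ IsManifold.maximalAtlas (𝓡 N) ∞ E) {x : E}
    (hx : x ∈ φ.source) : (mfderiv (𝓡 N) (𝓡 N) φ x).IsInvertible :=
  ⟨(mdifferentiable_of_mem_maximalAtlas hφ).mfderiv hx, rfl⟩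

theorem darboux_symm_covectorOfCoord (hφ : φ ∈ IsManifold.maximalAtlas (𝓡 N) ∞ E)
    {w : Idx N → ℝ} (hw : position w ∈ φ.target) :
    darboux φ ⟨φ.symm (position w),
      covectorOfCoord φ (φ.symm (position w)) fun k => w (Sum.inr k)⟩ = w := by
  funext i
  rcases i with i | i
  · change φ (φ.symm (position w)) i = _
    rw [φ.right_inv hw]
    rfl
  · have h1 := (isInvertible_mfderiv hφ (φ.map_target hw)).self_apply_inverse
      (EuclideanSpace.single i (1 : ℝ))
    let L : EuclideanSpace ℝ (Fin N) →L[ℝ] ℝ := ∑ k, w (Sum.inr k) • EuclideanSpace.proj k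
    have h2 : L (EuclideanSpace.single i 1) = w (Sum.inr i) := by
      simp [L, sum_apply]
    exact (congrArg L h1).trans h2

/-- Every jet of finite order over a chart is the jet of a loop in the cotangent bundle. -/
theorem exists_phaseLoop_of_jet (hφ : φ ∈ IsManifold.maximalAtlas (𝓡 N) ∞ E) {u : Jet N}
    (hu : u ∈ jetsOver φ.target) (k : ℕ) :
    ∃ c : PhaseLoop N E, c.base 0 ∈ φ.source ∧ ∀ m ≤ k, c.jet φ 0 m = u m := by
  obtain ⟨q, hq, hper, hmem, hjet⟩ := exists_loop_of_jet φ.open_target hu k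
  have hd (t : ℝ) := darboux_symm_covectorOfCoord hφ (hmem t)
  refine ⟨⟨fun t => ⟨φ.symm (position (q t)),
      covectorOfCoord φ (φ.symm (position (q t))) fun k => q t (Sum.inr k)⟩,
    fun t => congrArg (fun w : Idx N → ℝ => (⟨φ.symm (position w), covectorOfCoord φ
      (φ.symm (position w)) fun k => w (Sum.inr k)⟩ : CotangentPoint N E)) (hper t),
    φ.continuousOn_symm.comp_continuous (continuous_position.comp hq.continuous) hmem,
    fun t => ⟨φ, hφ, φ.map_target (hmem t), ?_⟩⟩, φ.map_target (hmem 0), fun m hm => ?_⟩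
  · simp only [hd]
    exact hq.contDiffAt
  · funext i
    simp only [PhaseLoop.jet, hd]
    exact hjet m hm i

/-- An expression of a function of loops in a chart is unique, since every jet is realised. -/
theorem IsChartExpr.eqOn (hφ : φ ∈ IsManifold.maximalAtlas (𝓡 N) ∞ E)
    {F : PhaseLoop N E → ℝ → ℝ} {k l : ℕ} {f g : Jet N → ℝ}
    (hf : IsChartExpr k φ F f) (hg : IsChartExpr l φ F g) :
    Set.EqOn f g (jetsOver φ.target) := by
  intro u hu
  obtain ⟨c, hc, hjet⟩ := exists_phaseLoop_of_jet hφ hu (max k l)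
  have hu' : position (c.jet φ 0 0) ∈ φ.target := by
    rw [hjet 0 (Nat.zero_le _)]
    exact hu
  obtain ⟨⟨f₁, -, hf₁⟩, hfF⟩ := hf
  obtain ⟨⟨g₁, -, hg₁⟩, hgF⟩ := hg
  have hfu : f u = f (c.jet φ 0) := by
    rw [hf₁ u hu, hf₁ _ hu']
    congr 1
    funext m
    exact (hjet m (by lia)).symm
  have hgu : g u = g (c.jet φ 0) := by
    rw [hg₁ u hu, hg₁ _ hu']
    congr 1
    funext m
    exact (hjet m (by lia)).symm
  rw [hfu, hgu, ← hfF c 0 hc, ← hgF c 0 hc]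

/-! ### Alekseev-Strobl functions in a chart -/

theorem oneFormInChart_mfderiv (hφ : φ ∈ IsManifold.maximalAtlas (𝓡 N) ∞ E)
    (α : (x : E) → TangentSpace (𝓡 N) x →L[ℝ] ℝ) {x : E} (hx : x ∈ φ.source)
    (v : TangentSpace (𝓡 N) x) :
    oneFormInChart φ α (φ x) (mfderiv (𝓡 N) (𝓡 N) φ x v) = α x v := by
  -- The base point is a variable because types depend on it and `φ.symm (φ x) = x` is not
  -- definitional.
  have key : ∀ (z : E) (w : EuclideanSpace ℝ (Fin N)), z = x → w = v → α z w = α x v := by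
    rintro _ _ rfl rfl
    rfl
  exact key _ _ (φ.left_inv hx) (mfderiv_symm_mfderiv hφ hx v)

theorem vecInChart_apply (hφ : φ ∈ IsManifold.maximalAtlas (𝓡 N) ∞ E)
    (ξ : (x : E) → TangentSpace (𝓡 N) x) {x : E} (hx : x ∈ φ.source) :
    vecInChart φ ξ (φ x) = mfderiv (𝓡 N) (𝓡 N) φ x (ξ x) := by
  have key : ∀ z : E, z = x → ∀ w : EuclideanSpace ℝ (Fin N), w = ξ z →
      mfderiv (𝓡 N) (𝓡 N) φ z w = mfderiv (𝓡 N) (𝓡 N) φ x (ξ x) := by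
    rintro _ rfl _ rfl
    rfl
  rw [← key _ (φ.left_inv hx) _ (mfderiv_symm_vecInChart hφ ξ (φ.map_source hx))]
  exact (mfderiv_mfderiv_symm hφ (φ.map_source hx) _).symm

theorem PhaseLoop.mdifferentiableAt_base (c : PhaseLoop N E) (t : ℝ) :
    MDifferentiableAt 𝓘(ℝ, ℝ) (𝓡 N) c.base t := by
  obtain ⟨ψ, hψ, hx, hsm⟩ := c.smooth t
  have h1 : ContDiffAt ℝ ∞ (fun s => ψ (c.base s)) t := by
    refine contDiffAt_euclidean.2 fun i => ?_
    exact contDiffAt_pi.1 hsm (Sum.inl i)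
  have h2 : MDifferentiableAt 𝓘(ℝ, ℝ) (𝓡 N) (fun s => ψ (c.base s)) t :=
    (h1.differentiableAt (by simp)).mdifferentiableAt
  have h3 := MDifferentiableAt.comp t
    ((mdifferentiable_of_mem_maximalAtlas hψ).mdifferentiableAt_symm (ψ.map_source hx)) h2
  refine h3.congr_of_eventuallyEq ?_
  filter_upwards [c.continuous_base.continuousAt.eventually (ψ.open_source.mem_nhds hx)] with s hs
  exact (ψ.left_inv hs).symm

theorem PhaseLoop.position_jet_zero (c : PhaseLoop N E) (t : ℝ) :
    position (c.jet φ t 0) = φ (c.base t) := by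
  ext i
  simp [position, PhaseLoop.jet, darboux, PhaseLoop.base]

theorem PhaseLoop.position_jet_one (hφ : φ ∈ IsManifold.maximalAtlas (𝓡 N) ∞ E)
    (c : PhaseLoop N E) {t : ℝ} (ht : c.base t ∈ φ.source) :
    position (c.jet φ t 1) = mfderiv (𝓡 N) (𝓡 N) φ (c.base t) (c.velocity t) := by
  have h1 := (mdifferentiable_of_mem_maximalAtlas hφ).mdifferentiableAt ht
  have h2 := mfderiv_comp t h1 (c.mdifferentiableAt_base t)
  have h3 : DifferentiableAt ℝ (φ ∘ c.base) t :=
    (h1.comp t (c.mdifferentiableAt_base t)).differentiableAt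
  rw [mfderiv_eq_fderiv] at h2
  have h4 : fderiv ℝ (φ ∘ c.base) t 1 =
      mfderiv (𝓡 N) (𝓡 N) φ (c.base t) (c.velocity t) := DFunLike.congr_fun h2 (1 : ℝ)
  rw [← h4]
  ext i
  have h5 := ((EuclideanSpace.proj (𝕜 := ℝ) i).hasFDerivAt.comp_hasDerivAt t
    h3.hasFDerivAt.hasDerivAt).deriv
  refine Eq.trans ?_ h5
  simp only [position, PhaseLoop.jet, iteratedDeriv_one]
  rfl

theorem asFunction_eq_current (hφ : φ ∈ IsManifold.maximalAtlas (𝓡 N) ∞ E) (a : GenSection N E)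
    (c : PhaseLoop N E) {t : ℝ} (ht : c.base t ∈ φ.source) :
    asFunction a c t =
      current (oneFormInChart φ a.form) (vecInChart φ a.vec) (c.jet φ t) := by
  rw [current, c.position_jet_zero, c.position_jet_one hφ ht, oneFormInChart_mfderiv hφ _ ht,
    asFunction]
  congr 1
  have h1 := sum_mul_apply_single ((c.momentum t).comp
    (mfderiv (𝓡 N) (𝓡 N) φ (c.base t)).inverse) (vecInChart φ a.vec (φ (c.base t)))
  have h2 : (mfderiv (𝓡 N) (𝓡 N) φ (c.base t)).inverse (vecInChart φ a.vec (φ (c.base t))) =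
      a.vec (c.base t) := by
    rw [vecInChart_apply hφ _ ht]
    exact (isInvertible_mfderiv hφ ht).inverse_apply_self _
  refine (congrArg (c.momentum t) h2).symm.trans (h1.symm.trans ?_)
  refine Finset.sum_congr rfl fun k _ => ?_
  rw [mul_comm]
  simp only [PhaseLoop.jet, iteratedDeriv_zero]
  rfl

theorem contDiff_position :
    ContDiff ℝ ∞ (position : (Idx N → ℝ) → EuclideanSpace ℝ (Fin N)) :=
  contDiff_euclidean.2 fun i => contDiff_apply ℝ ℝ (Sum.inl i)

theorem isChartExpr_asFunction [IsManifold (𝓡 N) ∞ E]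
    (hφ : φ ∈ IsManifold.maximalAtlas (𝓡 N) ∞ E) {a : GenSection N E} (ha : a.IsSmooth) :
    IsChartExpr 1 φ (asFunction a)
      (current (oneFormInChart φ a.form) (vecInChart φ a.vec)) := by
  refine ⟨⟨fun w => oneFormInChart φ a.form (position (w 0)) (position (w 1)) +
    ∑ k, w 0 (Sum.inr k) * vecInChart φ a.vec (position (w 0)) k, ?_, fun u _ => rfl⟩,
    fun c t ht => asFunction_eq_current hφ a c ht⟩
  have hpos (m : Fin 2) : ContDiffOn ℝ ∞ (fun w : Fin 2 → Idx N → ℝ => position (w m))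
      {w | position (w 0) ∈ φ.target} :=
    (contDiff_position.comp (contDiff_apply ℝ (Idx N → ℝ) m)).contDiffOn
  have hmaps : Set.MapsTo (fun w : Fin 2 → Idx N → ℝ => position (w 0))
      {w | position (w 0) ∈ φ.target} φ.target := fun w hw => hw
  refine (((ha.2 φ hφ).comp (hpos 0) hmaps).clm_apply (hpos 1)).add
    (ContDiffOn.sum fun k _ => ContDiffOn.mul ?_ ?_)
  · exact (contDiff_apply_apply ℝ ℝ (0 : Fin 2) (Sum.inr k : Idx N)).contDiffOn
  · exact contDiffOn_euclidean.1 ((contDiffOn_vecInChart hφ ha.1).comp (hpos 0) hmaps) k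

theorem isLocal_asFunction [IsManifold (𝓡 N) ∞ E] {a : GenSection N E} (ha : a.IsSmooth) :
    IsLocal (asFunction a) :=
  ⟨1, fun _ hφ => ⟨_, isChartExpr_asFunction hφ ha⟩⟩

theorem IsLocal.const_mul {F : PhaseLoop N E → ℝ → ℝ} (hF : IsLocal F) (r : ℝ) :
    IsLocal fun c t => r * F c t := by
  obtain ⟨k, hk⟩ := hF
  refine ⟨k, fun φ hφ => ?_⟩
  obtain ⟨f, ⟨g, hg, hfg⟩, hfF⟩ := hk φ hφ
  exact ⟨fun u => r * f u, ⟨fun w => r * g w, contDiffOn_const.mul hg,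
    fun u hu => congrArg (r * ·) (hfg u hu)⟩, fun c t ht => congrArg (r * ·) (hfF c t ht)⟩

/-- The expression of the canonical pairing in a chart. -/
def pairingInChart (φ : OpenPartialHomeomorph E (EuclideanSpace ℝ (Fin N)))
    (a b : GenSection N E) (y : EuclideanSpace ℝ (Fin N)) : ℝ :=
  (1 / 2 : ℝ) * (oneFormInChart φ a.form y (vecInChart φ b.vec y) +
    oneFormInChart φ b.form y (vecInChart φ a.vec y))

theorem pairingInChart_apply (hφ : φ ∈ IsManifold.maximalAtlas (𝓡 N) ∞ E)
    (a b : GenSection N E) {x : E} (hx : x ∈ φ.source) :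
    pairingInChart φ a b (φ x) = a.pairing b x := by
  rw [pairingInChart, oneFormInChart_vecInChart hφ _ _ (φ.map_source hx),
    oneFormInChart_vecInChart hφ _ _ (φ.map_source hx), φ.left_inv hx]
  rfl

theorem isLocal_pairing [IsManifold (𝓡 N) ∞ E] {a b : GenSection N E} (ha : a.IsSmooth)
    (hb : b.IsSmooth) : IsLocal fun (c : PhaseLoop N E) t => a.pairing b (c.base t) := by
  refine ⟨0, fun φ hφ => ⟨fun u => pairingInChart φ a b (position (u 0)),
    ⟨fun w => pairingInChart φ a b (position (w 0)), ?_, fun u _ => rfl⟩, fun c t ht => ?_⟩⟩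
  · have h : ContDiffOn ℝ ∞ (pairingInChart φ a b) φ.target :=
      contDiffOn_const.mul (((ha.2 φ hφ).clm_apply (contDiffOn_vecInChart hφ hb.1)).add
        ((hb.2 φ hφ).clm_apply (contDiffOn_vecInChart hφ ha.1)))
    exact h.comp (contDiff_position.comp (contDiff_apply ℝ (Idx N → ℝ) 0)).contDiffOn
      fun w hw => hw
  · change _ = pairingInChart φ a b (position (c.jet φ t 0))
    rw [c.position_jet_zero, pairingInChart_apply hφ a b ht]

theorem isLocal_zero : IsLocal (N := N) (E := E) fun _ _ => 0 :=
  ⟨0, fun _ _ => ⟨fun _ => 0, ⟨fun _ => 0, contDiffOn_const, fun _ _ => rfl⟩, fun _ _ _ => rfl⟩⟩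

/-! ### The operations on Alekseev-Strobl functions -/

theorem iteratedDeriv_affine (α β : ℝ) (j : ℕ) :
    iteratedDeriv (j + 1) (fun l : ℝ => α + l * β) 0 = if j = 0 then β else 0 := by
  have h : deriv (fun l : ℝ => α + l * β) = fun _ => β := by
    funext l
    simp
  rw [iteratedDeriv_succ', h, iteratedDeriv_const]

variable {H : (x : E) → TangentSpace (𝓡 N) x [⋀^Fin 3]→L[ℝ] ℝ} {a b : GenSection N E}
  {f g : Jet N → ℝ} {k l : ℕ}

theorem pairingInChart_comm (φ : OpenPartialHomeomorph E (EuclideanSpace ℝ (Fin N)))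
    (a b : GenSection N E) : pairingInChart φ a b = pairingInChart φ b a := by
  funext y
  rw [pairingInChart, pairingInChart, add_comm]

theorem PhaseLoop.jet_mem_jetsOver (c : PhaseLoop N E) {t : ℝ} (ht : c.base t ∈ φ.source) :
    c.jet φ t ∈ jetsOver φ.target := by
  change position (c.jet φ t 0) ∈ φ.target
  rw [c.position_jet_zero]
  exact φ.map_source ht

variable [IsManifold (𝓡 N) ∞ E]

/-- The `λ`-bracket of two Alekseev-Strobl functions is the affine function of `λ` whose constant
term is given by the twisted Dorfman bracket and whose slope is given by the pairing. -/
theorem lambdaBracket_asFunction (hφ : φ ∈ IsManifold.maximalAtlas (𝓡 N) ∞ E)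
    (ha : a.IsSmooth) (hb : b.IsSmooth) (ε : ℝ) (hf : IsChartExpr k φ (asFunction a) f)
    (hg : IsChartExpr l φ (asFunction b) g) {u : Jet N} (hu : u ∈ jetsOver φ.target) (r : ℝ) :
    lambdaBracket (poissonTensor ε (threeFormInChart φ H)) r f g u =
      ε * current (oneFormInChart φ (GenSection.dorfman H a b).form)
        (vecInChart φ (GenSection.dorfman H a b).vec) u +
      r * (ε * (2 * pairingInChart φ a b (position (u 0)))) := by
  have hnhds := φ.open_target.mem_nhds (show position (u 0) ∈ φ.target from hu)
  have hA := ((ha.2 φ hφ).contDiffAt hnhds).differentiableAt (by simp)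
  have hC := ((hb.2 φ hφ).contDiffAt hnhds).differentiableAt (by simp)
  have hX := ((contDiffOn_vecInChart hφ ha.1).contDiffAt hnhds).differentiableAt (by simp)
  have hY := ((contDiffOn_vecInChart hφ hb.1).contDiffAt hnhds).differentiableAt (by simp)
  rw [lambdaBracket_congr φ.open_target _ r (hf.eqOn hφ (isChartExpr_asFunction hφ ha))
    (hg.eqOn hφ (isChartExpr_asFunction hφ hb)) hu, lambdaBracket_current ε r _ hA hC hX hY,
    current, oneFormInChart_dorfman hφ H ha hb hu, pairingInChart]
  have hvec : vecInChart φ (GenSection.dorfman H a b).vec (position (u 0)) = _ :=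
    vecInChart_mlieBracket hφ ha.1 hb.1 hu
  rw [hvec]
  ring

theorem jProduct_asFunction (hφ : φ ∈ IsManifold.maximalAtlas (𝓡 N) ∞ E)
    (ha : a.IsSmooth) (hb : b.IsSmooth) (ε : ℝ) (hf : IsChartExpr k φ (asFunction a) f)
    (hg : IsChartExpr l φ (asFunction b) g) {u : Jet N} (hu : u ∈ jetsOver φ.target) (j : ℕ) :
    jProduct (poissonTensor ε (threeFormInChart φ H)) (j + 1) f g u =
      if j = 0 then ε * (2 * pairingInChart φ a b (position (u 0))) else 0 := by
  simp only [jProduct, lambdaBracket_asFunction hφ ha hb ε hf hg hu, iteratedDeriv_affine]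

theorem inducedPairing_asFunction (hφ : φ ∈ IsManifold.maximalAtlas (𝓡 N) ∞ E)
    (ha : a.IsSmooth) (hb : b.IsSmooth) (ε : ℝ) (hf : IsChartExpr k φ (asFunction a) f)
    (hg : IsChartExpr l φ (asFunction b) g) {u : Jet N} (hu : u ∈ jetsOver φ.target) :
    inducedPairing (poissonTensor ε (threeFormInChart φ H)) f g u =
      ε * (2 * pairingInChart φ a b (position (u 0))) := by
  rw [inducedPairing, finsum_eq_single _ 0]
  · simp only [Function.iterate_zero, id_eq, jProduct_asFunction hφ ha hb ε hf hg hu,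
      jProduct_asFunction hφ hb ha ε hg hf hu, pairingInChart_comm φ b a,
      if_true]
    norm_num [Nat.factorial]
    ring
  · intro j hj
    have h0 : Set.EqOn (fun w => jProduct (poissonTensor ε (threeFormInChart φ H)) (j + 1) f g w +
        jProduct (poissonTensor ε (threeFormInChart φ H)) (j + 1) g f w) 0
        (jetsOver φ.target) := fun w hw => by
      simp [jProduct_asFunction hφ ha hb ε hf hg hw, jProduct_asFunction hφ hb ha ε hg hf hw, hj]
    rw [negShiftD_iterate_congr φ.open_target 0 j h0 hu, negShiftD_iterate_zero]
    exact mul_zero _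

end Loops

end ASCurrents

end

open scoped Manifold ContDiff in
theorem proposition8p1 {N : ℕ} {E : Type*} [TopologicalSpace E]
    [ChartedSpace (EuclideanSpace ℝ (Fin N)) E] [IsManifold (𝓡 N) ∞ E]
    (H : (x : E) → TangentSpace (𝓡 N) x [⋀^Fin 3]→L[ℝ] ℝ)
    (hH : ASCurrents.IsSmoothThreeForm H) (hdH : ASCurrents.IsClosedThreeForm H)
    (a b : ASCurrents.GenSection N E) (ha : a.IsSmooth) (hb : b.IsSmooth)
    (ε : ℝ) (hε : ε = 1 ∨ ε = -1) :
    (ASCurrents.GenSection.dorfman H a b).IsSmooth ∧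
    ASCurrents.IsDorfman ε H (ASCurrents.asFunction a) (ASCurrents.asFunction b)
      (fun c t => ε * ASCurrents.asFunction (ASCurrents.GenSection.dorfman H a b) c t) ∧
    ASCurrents.IsPairing ε H (ASCurrents.asFunction a) (ASCurrents.asFunction b)
      (fun c t => ε * (2 * a.pairing b (c.base t))) ∧
    ASCurrents.IsJProduct ε H 1 (ASCurrents.asFunction a) (ASCurrents.asFunction b)
      (fun c t => ε * (2 * a.pairing b (c.base t))) ∧
    ∀ j : ℕ, 2 ≤ j →
      ASCurrents.IsJProduct ε H j (ASCurrents.asFunction a) (ASCurrents.asFunction b)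
        (fun _ _ => 0) := by
  have hab := ASCurrents.GenSection.IsSmooth.dorfman hH ha hb
  have hla := ASCurrents.isLocal_asFunction ha
  have hlb := ASCurrents.isLocal_asFunction hb
  have hlp := ((ASCurrents.isLocal_pairing ha hb).const_mul 2).const_mul ε
  refine ⟨hab, ⟨hla, hlb, (ASCurrents.isLocal_asFunction hab).const_mul ε, ?_⟩,
    ⟨hla, hlb, hlp, ?_⟩, ⟨hla, hlb, hlp, ?_⟩, fun j hj => ⟨hla, hlb, ASCurrents.isLocal_zero, ?_⟩⟩
  · intro φ hφ k l f g hf hg c t ht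
    have hu := c.jet_mem_jetsOver ht
    change ASCurrents.lambdaBracket _ 0 f g _ = _
    rw [ASCurrents.lambdaBracket_asFunction hφ ha hb ε hf hg hu,
      ← ASCurrents.asFunction_eq_current hφ _ c ht, zero_mul, add_zero]
  · intro φ hφ k l f g hf hg c t ht
    have hu := c.jet_mem_jetsOver ht
    refine (ASCurrents.inducedPairing_asFunction hφ ha hb ε hf hg hu).trans ?_
    rw [c.position_jet_zero,
      ASCurrents.pairingInChart_apply hφ a b ht]
  · intro φ hφ k l f g hf hg c t ht
    have hu := c.jet_mem_jetsOver ht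
    refine (ASCurrents.jProduct_asFunction hφ ha hb ε hf hg hu 0).trans ?_
    rw [if_pos rfl, c.position_jet_zero,
      ASCurrents.pairingInChart_apply hφ a b ht]
  · intro φ hφ k l f g hf hg c t ht
    have hu := c.jet_mem_jetsOver ht
    obtain ⟨i, rfl⟩ := Nat.exists_eq_add_of_le' hj
    exact (ASCurrents.jProduct_asFunction hφ ha hb ε hf hg hu (i + 1)).trans
      (if_neg i.succ_ne_zero)
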